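/- Let $p$ be an odd prime, $n\ge 0$ an integer, and let $\mathcal F_n$ be the free pro-$p$ group on $x_1,\dots,x_n$. Write $(g,h)=g^{-1}h^{-1}gh$ and $h^g=g^{-1}hg$. For a closed subgroup $\mathcal H$ of $\mathcal F_n$ let $\Phi(\mathcal H)=\mathcal H^p(\mathcal H,\mathcal H)$ be its Frattini subgroup, i.e. the closed subgroup generated by the $p$-th powers and the commutators of elements of $\mathcal H$, and let $\Phi^{(2)}(\mathcal F_n)=\Phi(\Phi(\mathcal F_n))$. Let $E_n=\mathcal F_n/\Phi(\mathcal F_n)$ and $M_n=\Phi(\mathcal F_n)/\Phi^{(2)}(\mathcal F_n)$, written additively; it is a right $\mathbf F_pE_n$-module through $[\alpha]\cdot x=[\alpha^x]$. Put $X_i=x_i-1\in\mathbf F_pE_n$ and $X^\nu=X_1^{\nu_1}\cdots X_n^{\nu_n}$ for $\nu\in\{0,\dots,p-1\}^n$. We write $x_i^p$ and $(x_i,x_j)$ also for the classes of these elements in $M_n$. Let $F_{n,p}$ be the free $\mathbf F_pE_n$-module on symbols $e_i$ ($1\le i\le n$) and $e_{(i,j)}$ ($1\le i<j\le n$), and let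 $\psi:F_{n,p}\to M_n$ be the $\mathbf F_pE_n$-linear map with $\psi(e_i)=x_i^p$, $\psi(e_{(i,j)})=(x_i,x_j)$. (a) (Presentation.) As an $\mathbf F_pE_n$-module, $M_n$ is presented by the generators $x_i^p$ ($1\le i\le n$) and $(x_i,x_j)$ ($i<j$) and the relations 1. $x_i^p\cdot X_i=0$; 2. $x_i^p\cdot X_j=-(x_j,x_i)X_i^{p-1}$ if $i>j$; 3. $x_i^p\cdot X_j=(x_i,x_j)X_i^{p-1}$ if $i<j$; 4. $(x_i,x_j)X_k+(x_j,x_k)X_i-(x_i,x_k)X_j=0$ if $i<j<k$. That is, $\psi$ is surjective and $\ker\psi$ is the submodule generated by the elements $e_iX_i$, $e_iX_j+e_{(j,i)}X_i^{p-1}$ ($i>j$), $e_iX_j-e_{(i,j)}X_i^{p-1}$ ($i<j$) and $e_{(i,j)}X_k+e_{(j,k)}X_i-e_{(i,k)}X_j$ ($i<j<k$). (b) (Basis of the kernel.) The following vectors, with $m\in\{0,\dots,p-1\}^n$, together form an $\mathbf F_p$-basis of $\ker\psi$: - $R(i,m)$, for $1\le i\le n$ and $m\ne 0$: if $m_i\neq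 0$, $R(i,m)=e_iX^m$; if $m_i=0$ and $j=\max\{s: m_s\ne0\}$, then $R(i,m)=e_iX^m-e_{(i,j)}X_i^{p-1}X_j^{m_j-1}\prod_{s\ne i,j}X_s^{m_s}$ when $i<j$, and $R(i,m)=e_iX^m+e_{(j,i)}X_i^{p-1}X_j^{m_j-1}\prod_{s\ne i,j}X_s^{m_s}$ when $i>j$; - $R(i,j,m)=e_{(i,j)}X_j^{p-1}X_i^{p-1}X^m$, for $i<j$ and $m_s=0$ for all $s\ge i$; - $jac_1(i,j,k,m)=e_{(i,j)}X_kX^m+e_{(j,k)}X_iX^m-e_{(i,k)}X_jX^m$, for $i<j<k$, $m_k\ne p-1$ and $m_s=0$ for all $s>k$; - $jac_2(i,j,k,m)=e_{(i,k)}X_k^{p-1}X_jX^m-e_{(j,k)}X_k^{p-1}X_iX^m$, for $i<j<k$, $m_j\ne p-1$ and $m_s=0$ for all $s>j$. (c) (Basis of $M_n$.) The vectors $x_i^p$ ($1\le i\le n$), together with the vectors $(x_i,x_j)X^\nu$ for $i<j$ and $\nu\in\{0,\dots,p-1\}^n$ such that 1. $\nu_s=0$ for all $s>j$, 2. $\nu_i\ne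 p-1$ or $\nu_j\ne p-1$, 3. if $\nu_j=p-1$ then $\nu_k=0$ for all $i<k<j$, form an $\mathbf F_p$-basis of $M_n$. -/

import Mathlib

noncomputable section

/-! ### The free pro-`p` group of rank `n` -/

/-- The normal subgroups of `p`-power index of the (discrete) free group of rank `n`. -/
structure PowIndexNormal (p n : ℕ) where
  toSubgroup : Subgroup (FreeGroup (Fin n))
  normal : toSubgroup.Normal
  index_eq : ∃ k : ℕ, toSubgroup.index = p ^ k

instance PowIndexNormal.instNormal {p n : ℕ} (N : PowIndexNormal p n) : N.toSubgroup.Normal :=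
  N.normal

/-- The inverse limit of the finite `p`-group quotients of the free group of rank `n`, as the
subgroup of compatible families in the product of these quotients. -/
def freeProPLimit (p n : ℕ) :
    Subgroup (∀ N : PowIndexNormal p n, FreeGroup (Fin n) ⧸ N.toSubgroup) where
  carrier := {g | ∀ (N K : PowIndexNormal p n) (h : N.toSubgroup ≤ K.toSubgroup),
    QuotientGroup.map N.toSubgroup K.toSubgroup (MonoidHom.id _) h (g N) = g K}
  mul_mem' := by
    intro a b ha hb N K h
    simp only [Pi.mul_apply, map_mul]
    rw [ha N K h, hb N K h]
  one_mem' := by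
    intro N K h
    simp only [Pi.one_apply, map_one]
  inv_mem' := by
    intro a ha N K h
    simp only [Pi.inv_apply, map_inv]
    rw [ha N K h]

/-- The free pro-`p` group of rank `n`: the pro-`p` completion of the free group of rank `n`. -/
def FreeProP (p n : ℕ) : Type := freeProPLimit p n

instance FreeProP.instGroup (p n : ℕ) : Group (FreeProP p n) :=
  inferInstanceAs (Group (freeProPLimit p n))

/-- The projection of the free pro-`p` group to a finite quotient of the free group. -/
def FreeProP.proj {p n : ℕ} (N : PowIndexNormal p n) :
    FreeProP p n →* FreeGroup (Fin n) ⧸ N.toSubgroup :=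
  (Pi.evalMonoidHom _ N).comp (freeProPLimit p n).subtype

/-- The profinite topology: the coarsest one for which the projections to the (discrete) finite
quotients are continuous. -/
instance FreeProP.instTopologicalSpace (p n : ℕ) : TopologicalSpace (FreeProP p n) :=
  ⨅ N : PowIndexNormal p n, TopologicalSpace.induced (FreeProP.proj N) ⊥

instance FreeProP.instIsTopologicalGroup (p n : ℕ) : IsTopologicalGroup (FreeProP p n) :=
  topologicalGroup_iInf fun N => by
    let _ : TopologicalSpace (FreeGroup (Fin n) ⧸ N.toSubgroup) := ⊥
    have _ : DiscreteTopology (FreeGroup (Fin n) ⧸ N.toSubgroup) := ⟨rfl⟩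
    exact topologicalGroup_induced (FreeProP.proj N)

/-- The free generators `x₁, …, xₙ`. -/
def FreeProP.gen (p : ℕ) {n : ℕ} (i : Fin n) : FreeProP p n :=
  ⟨fun _ => QuotientGroup.mk (FreeGroup.of i), fun _ _ _ => rfl⟩

/-! ### Frattini subgroups and the module `Φ(G) / Φ(Φ(G))` -/

section Frattini

/-- `Hᵖ(H, H)` for a subgroup `H` of a topological group: the closed subgroup generated by the
`p`-th powers and the commutators of elements of `H`. For a closed subgroup `H` of a pro-`p` group,
it is the Frattini subgroup of `H`. -/
def frattiniOf {G : Type*} [Group G] [TopologicalSpace G] [IsTopologicalGroup G]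
    (p : ℕ) (H : Subgroup G) : Subgroup G :=
  (Subgroup.closure ({g | ∃ a ∈ H, g = a ^ p} ∪
    {g | ∃ a ∈ H, ∃ b ∈ H, g = a⁻¹ * b⁻¹ * a * b})).topologicalClosure

variable {G : Type*} [Group G] [TopologicalSpace G] [IsTopologicalGroup G]

theorem pow_mem_frattiniOf (p : ℕ) {H : Subgroup G} {a : G} (ha : a ∈ H) :
    a ^ p ∈ frattiniOf p H :=
  Subgroup.le_topologicalClosure _ (Subgroup.subset_closure (Or.inl ⟨a, ha, rfl⟩))

theorem comm_mem_frattiniOf (p : ℕ) {H : Subgroup G} {a b : G} (ha : a ∈ H) (hb : b ∈ H) :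
    a⁻¹ * b⁻¹ * a * b ∈ frattiniOf p H :=
  Subgroup.le_topologicalClosure _ (Subgroup.subset_closure (Or.inr ⟨a, ha, b, hb, rfl⟩))

instance frattiniOf_normal (p : ℕ) (H : Subgroup G) [hH : H.Normal] :
    (frattiniOf p H).Normal := by
  have key : (Subgroup.closure ({g | ∃ a ∈ H, g = a ^ p} ∪
      {g | ∃ a ∈ H, ∃ b ∈ H, g = a⁻¹ * b⁻¹ * a * b})).Normal := by
    refine ⟨fun x hx g => ?_⟩
    induction hx using Subgroup.closure_induction with
    | mem x hx =>
      apply Subgroup.subset_closure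
      rcases hx with ⟨a, ha, rfl⟩ | ⟨a, ha, b, hb, rfl⟩
      · exact Or.inl ⟨g * a * g⁻¹, hH.conj_mem a ha g, by simp⟩
      · exact Or.inr ⟨g * a * g⁻¹, hH.conj_mem a ha g, g * b * g⁻¹, hH.conj_mem b hb g, by group⟩
    | one => simp
    | mul x y _ _ hx hy =>
      have h : g * (x * y) * g⁻¹ = (g * x * g⁻¹) * (g * y * g⁻¹) := by group
      rw [h]
      exact mul_mem hx hy
    | inv x _ hx =>
      have h : g * x⁻¹ * g⁻¹ = (g * x * g⁻¹)⁻¹ := by group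
      rw [h]
      exact inv_mem hx
  exact Subgroup.is_normal_topologicalClosure _

end Frattini

section FrattiniModule

/-- `Φ(G)` for a pro-`p` group `G`. -/
def Phi (p : ℕ) (G : Type*) [Group G] [TopologicalSpace G] [IsTopologicalGroup G] : Subgroup G :=
  frattiniOf p ⊤

/-- `Φ⁽²⁾(G) = Φ(Φ(G))`, as a subgroup of `G`. -/
def PhiTwo (p : ℕ) (G : Type*) [Group G] [TopologicalSpace G] [IsTopologicalGroup G] :
    Subgroup G :=
  frattiniOf p (Phi p G)

variable (p : ℕ) (G : Type*) [Group G] [TopologicalSpace G] [IsTopologicalGroup G]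

instance Phi_normal : (Phi p G).Normal := frattiniOf_normal p ⊤

instance PhiTwo_normal : (PhiTwo p G).Normal := frattiniOf_normal p (Phi p G)

/-- The elementary abelian quotient `G / Φ(G)`. -/
def FrattiniQuotient : Type _ := G ⧸ Phi p G

instance FrattiniQuotient.instGroup : Group (FrattiniQuotient p G) :=
  inferInstanceAs (Group (G ⧸ Phi p G))

instance FrattiniQuotient.instCommGroup : CommGroup (FrattiniQuotient p G) :=
  { FrattiniQuotient.instGroup p G with
    mul_comm := by
      intro a b
      induction a using QuotientGroup.induction_on with | H a =>
      induction b using QuotientGroup.induction_on with | H b =>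
      refine QuotientGroup.eq.2 ?_
      have h : (a * b)⁻¹ * (b * a) = b⁻¹ * a⁻¹ * b * a := by group
      rw [h]
      exact comm_mem_frattiniOf p (Subgroup.mem_top _) (Subgroup.mem_top _) }

/-- The class in `G / Φ(G)` of an element of `G`. -/
def FrattiniQuotient.mk : G →* FrattiniQuotient p G := QuotientGroup.mk' (Phi p G)

/-- `M_G = Φ(G) / Φ⁽²⁾(G)`, written additively. -/
def FrattiniModule : Type _ := Additive (Phi p G ⧸ (PhiTwo p G).subgroupOf (Phi p G))

instance FrattiniModule.instAddGroup : AddGroup (FrattiniModule p G) :=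
  inferInstanceAs (AddGroup (Additive (Phi p G ⧸ (PhiTwo p G).subgroupOf (Phi p G))))

instance FrattiniModule.instAddCommGroup : AddCommGroup (FrattiniModule p G) :=
  { FrattiniModule.instAddGroup p G with
    add_comm := by
      intro a b
      change Phi p G ⧸ (PhiTwo p G).subgroupOf (Phi p G) at a b
      induction a using QuotientGroup.induction_on with | H a =>
      induction b using QuotientGroup.induction_on with | H b =>
      refine QuotientGroup.eq.2 ?_
      have h : (a * b)⁻¹ * (b * a) = b⁻¹ * a⁻¹ * b * a := by group
      rw [h]
      exact comm_mem_frattiniOf p b.2 a.2 }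

/-- The class `[α]` in `M_G` of an element `α` of `Φ(G)`. -/
def FrattiniModule.mk : Additive (Phi p G) →+ FrattiniModule p G :=
  MonoidHom.toAdditive (QuotientGroup.mk' ((PhiTwo p G).subgroupOf (Phi p G)))

variable {p G}

theorem FrattiniModule.mk_surjective : Function.Surjective (FrattiniModule.mk p G) :=
  QuotientGroup.mk'_surjective ((PhiTwo p G).subgroupOf (Phi p G))

theorem FrattiniModule.mk_eq_mk {α β : Phi p G} :
    FrattiniModule.mk p G (.ofMul α) = FrattiniModule.mk p G (.ofMul β) ↔
      (α : G)⁻¹ * β ∈ PhiTwo p G :=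
  QuotientGroup.eq (s := (PhiTwo p G).subgroupOf (Phi p G)) (a := α) (b := β)

theorem FrattiniModule.nsmul_eq_zero (m : FrattiniModule p G) : p • m = 0 := by
  obtain ⟨α, rfl⟩ := FrattiniModule.mk_surjective m
  rw [← map_nsmul, ← map_zero (FrattiniModule.mk p G)]
  refine FrattiniModule.mk_eq_mk.2 ?_
  have h := inv_mem (pow_mem_frattiniOf p (H := Phi p G) α.toMul.2)
  simpa [PhiTwo] using h

instance FrattiniModule.instModuleZMod : Module (ZMod p) (FrattiniModule p G) :=
  AddCommGroup.zmodModule FrattiniModule.nsmul_eq_zero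

/-- `αᵍ = g⁻¹ α g` for `α ∈ Φ(G)` and `g ∈ G`. -/
def Phi.conj (g : G) : Phi p G →* Phi p G := (MulAut.conjNormal g⁻¹).toMonoidHom

theorem Phi.conj_coe (g : G) (α : Phi p G) : (Phi.conj g α : G) = g⁻¹ * α * g := by
  simp [Phi.conj]

/-- The map `[α] ↦ [αᵍ]` from `M_G` to itself. -/
def FrattiniModule.conj (g : G) : FrattiniModule p G →+ FrattiniModule p G :=
  MonoidHom.toAdditive
    (QuotientGroup.map ((PhiTwo p G).subgroupOf (Phi p G)) ((PhiTwo p G).subgroupOf (Phi p G))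
      (Phi.conj g) (by
        intro α hα
        rw [Subgroup.mem_comap, Subgroup.mem_subgroupOf, Phi.conj_coe]
        simpa using (PhiTwo_normal p G).conj_mem α (Subgroup.mem_subgroupOf.1 hα) g⁻¹))

theorem FrattiniModule.conj_mk (g : G) (α : Phi p G) :
    FrattiniModule.conj g (FrattiniModule.mk p G (.ofMul α)) =
      FrattiniModule.mk p G (.ofMul (Phi.conj g α)) := rfl

theorem FrattiniModule.conj_eq_of_mem {g h : G} (hgh : g⁻¹ * h ∈ Phi p G) :
    FrattiniModule.conj (p := p) g = FrattiniModule.conj h := by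
  ext m
  obtain ⟨α, rfl⟩ := FrattiniModule.mk_surjective m
  obtain ⟨α, rfl⟩ := Additive.ofMul.surjective α
  rw [FrattiniModule.conj_mk, FrattiniModule.conj_mk, FrattiniModule.mk_eq_mk,
    Phi.conj_coe, Phi.conj_coe]
  have h1 : (g⁻¹ * (α : G) * g)⁻¹ * (h⁻¹ * α * h) =
      (g⁻¹ * (α : G) * g)⁻¹ * (g⁻¹ * h)⁻¹ * (g⁻¹ * (α : G) * g) * (g⁻¹ * h) := by group
  rw [h1]
  refine comm_mem_frattiniOf p ?_ hgh
  have h2 := (Phi.conj g α).2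
  rwa [Phi.conj_coe] at h2

variable (p G)

/-- The action of `G / Φ(G)` on `M_G` by conjugation, `[α] · g = [g⁻¹ α g]`. As `G / Φ(G)` is
abelian, this right action is also a left action. -/
def FrattiniModule.rep : Representation (ZMod p) (FrattiniQuotient p G) (FrattiniModule p G) :=
  QuotientGroup.lift (Phi p G)
    { toFun := fun g => (FrattiniModule.conj g).toZModLinearMap p
      map_one' := by
        refine LinearMap.ext fun m => ?_
        obtain ⟨α, rfl⟩ := FrattiniModule.mk_surjective m
        obtain ⟨α, rfl⟩ := Additive.ofMul.surjective α
        change FrattiniModule.conj 1 _ = _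
        rw [FrattiniModule.conj_mk, Module.End.one_apply, FrattiniModule.mk_eq_mk, Phi.conj_coe]
        simp [one_mem]
      map_mul' := by
        intro g h
        refine LinearMap.ext fun m => ?_
        change FrattiniModule.conj (g * h) m = FrattiniModule.conj g (FrattiniModule.conj h m)
        have hgh : (g * h)⁻¹ * (h * g) ∈ Phi p G := by
          have h1 : (g * h)⁻¹ * (h * g) = h⁻¹ * g⁻¹ * h * g := by group
          rw [h1]
          exact comm_mem_frattiniOf p (Subgroup.mem_top _) (Subgroup.mem_top _)
        rw [FrattiniModule.conj_eq_of_mem hgh]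
        obtain ⟨α, rfl⟩ := FrattiniModule.mk_surjective m
        obtain ⟨α, rfl⟩ := Additive.ofMul.surjective α
        rw [FrattiniModule.conj_mk, FrattiniModule.conj_mk, FrattiniModule.conj_mk]
        congr 2
        apply Subtype.ext
        simp only [Phi.conj_coe]
        group }
    (by
      intro g hg
      rw [MonoidHom.mem_ker]
      refine LinearMap.ext fun m => ?_
      obtain ⟨α, rfl⟩ := FrattiniModule.mk_surjective m
      obtain ⟨α, rfl⟩ := Additive.ofMul.surjective α
      change FrattiniModule.conj g _ = _
      rw [FrattiniModule.conj_eq_of_mem (h := 1) (by simpa using inv_mem hg),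
        FrattiniModule.conj_mk, Module.End.one_apply, FrattiniModule.mk_eq_mk, Phi.conj_coe]
      simp [one_mem])

theorem FrattiniModule.rep_mk (g : G) (m : FrattiniModule p G) :
    FrattiniModule.rep p G (FrattiniQuotient.mk p G g) m = FrattiniModule.conj g m := rfl

/-- The group algebra `𝐅ₚ[G / Φ(G)]`. -/
abbrev FrattiniAlgebra : Type _ := MonoidAlgebra (ZMod p) (FrattiniQuotient p G)

/-- `M_G` as a module over `𝐅ₚ[G / Φ(G)]`. -/
instance FrattiniModule.instModule : Module (FrattiniAlgebra p G) (FrattiniModule p G) :=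
  Module.compHom (FrattiniModule p G) (FrattiniModule.rep p G).asAlgebraHom.toRingHom

theorem FrattiniModule.smul_def (a : FrattiniAlgebra p G) (m : FrattiniModule p G) :
    a • m = (FrattiniModule.rep p G).asAlgebraHom a m := rfl

theorem FrattiniModule.of_smul (g : G) (m : FrattiniModule p G) :
    MonoidAlgebra.of (ZMod p) _ (FrattiniQuotient.mk p G g) • m = FrattiniModule.conj g m := by
  rw [FrattiniModule.smul_def, Representation.asAlgebraHom_of, FrattiniModule.rep_mk]

instance FrattiniModule.instIsScalarTower :
    IsScalarTower (ZMod p) (FrattiniAlgebra p G) (FrattiniModule p G) :=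
  ⟨fun c a m => by simp only [FrattiniModule.smul_def, map_smul, LinearMap.smul_apply]⟩

end FrattiniModule

/-! ### The module `Mₙ` of the free pro-`p` group -/

section FreeModule

variable (p n : ℕ)

/-- The group algebra `𝐅ₚEₙ`, where `Eₙ = Fₙ / Φ(Fₙ)`. -/
abbrev AlgE : Type := FrattiniAlgebra p (FreeProP p n)

/-- The `𝐅ₚEₙ`-module `Mₙ = Φ(Fₙ) / Φ⁽²⁾(Fₙ)`. -/
abbrev ModM : Type := FrattiniModule p (FreeProP p n)

variable {n}

/-- `Xᵢ = xᵢ - 1` in `𝐅ₚEₙ`. -/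
def varX (i : Fin n) : AlgE p n :=
  MonoidAlgebra.of (ZMod p) _ (FrattiniQuotient.mk p (FreeProP p n) (FreeProP.gen p i)) - 1

/-- `X^ν = X₁^ν₁ ⋯ Xₙ^νₙ`, for `ν ∈ {0, …, p - 1}ⁿ`. -/
def monX (ν : Fin n → Fin p) : AlgE p n := ∏ s, varX p s ^ (ν s : ℕ)

/-- The class of `xᵢᵖ` in `Mₙ`. -/
def powClass (i : Fin n) : ModM p n :=
  FrattiniModule.mk p (FreeProP p n)
    (.ofMul ⟨FreeProP.gen p i ^ p, pow_mem_frattiniOf p (Subgroup.mem_top _)⟩)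

/-- The class of `(xᵢ, xⱼ) = xᵢ⁻¹ xⱼ⁻¹ xᵢ xⱼ` in `Mₙ`. -/
def commClass (i j : Fin n) : ModM p n :=
  FrattiniModule.mk p (FreeProP p n)
    (.ofMul ⟨(FreeProP.gen p i)⁻¹ * (FreeProP.gen p j)⁻¹ * FreeProP.gen p i * FreeProP.gen p j,
      comm_mem_frattiniOf p (Subgroup.mem_top _) (Subgroup.mem_top _)⟩)

variable (n)

/-- The free `𝐅ₚEₙ`-module on symbols `eᵢ` and `e₍ᵢ,ⱼ₎` for `i < j`. -/
abbrev FreeMod : Type := (Fin n ⊕ {q : Fin n × Fin n // q.1 < q.2}) →₀ AlgE p n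

/-- The linear map with `ψ(eᵢ) = xᵢᵖ` and `ψ(e₍ᵢ,ⱼ₎) = (xᵢ, xⱼ)`. -/
def psi : FreeMod p n →ₗ[AlgE p n] ModM p n :=
  Finsupp.linearCombination (AlgE p n)
    (Sum.elim (fun i => powClass p i) (fun q => commClass p q.1.1 q.1.2))

variable {n}

/-- The basis element `eᵢ`. -/
def eP (i : Fin n) : FreeMod p n := Finsupp.single (Sum.inl i) 1

/-- The basis element `e₍ᵢ,ⱼ₎`, for `i < j`. -/
def eC {i j : Fin n} (h : i < j) : FreeMod p n := Finsupp.single (Sum.inr ⟨(i, j), h⟩) 1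

variable (n)

/-- The defining relations of `Mₙ`, as elements of the free module. -/
inductive DefRel : FreeMod p n → Prop
  | powSelf (i : Fin n) : DefRel (varX p i • eP p i)
  | powLt (i j : Fin n) (h : i < j) :
      DefRel (varX p j • eP p i - varX p i ^ (p - 1) • eC p h)
  | powGt (i j : Fin n) (h : j < i) :
      DefRel (varX p j • eP p i + varX p i ^ (p - 1) • eC p h)
  | jacobi (i j k : Fin n) (hij : i < j) (hjk : j < k) :
      DefRel (varX p k • eC p hij + varX p i • eC p hjk - varX p j • eC p (hij.trans hjk))

/-- The index set of the family `kerVec`. In `rPowLt` and `rPowGt`, `j` is the largest `s` with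
`mₛ ≠ 0`. -/
inductive KerIndex : Type
  | rPow (i : Fin n) (m : Fin n → Fin p) (hi : (m i : ℕ) ≠ 0)
  | rPowLt (i j : Fin n) (h : i < j) (m : Fin n → Fin p) (hi : (m i : ℕ) = 0)
      (hj : (m j : ℕ) ≠ 0) (hm : ∀ s, j < s → (m s : ℕ) = 0)
  | rPowGt (i j : Fin n) (h : j < i) (m : Fin n → Fin p) (hi : (m i : ℕ) = 0)
      (hj : (m j : ℕ) ≠ 0) (hm : ∀ s, j < s → (m s : ℕ) = 0)
  | rComm (i j : Fin n) (h : i < j) (m : Fin n → Fin p) (hm : ∀ s, i ≤ s → (m s : ℕ) = 0)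
  | jac₁ (i j k : Fin n) (hij : i < j) (hjk : j < k) (m : Fin n → Fin p)
      (hk : (m k : ℕ) ≠ p - 1) (hm : ∀ s, k < s → (m s : ℕ) = 0)
  | jac₂ (i j k : Fin n) (hij : i < j) (hjk : j < k) (m : Fin n → Fin p)
      (hj : (m j : ℕ) ≠ p - 1) (hm : ∀ s, j < s → (m s : ℕ) = 0)

variable {n}

open Finset in
/-- The vectors `R(i,m)`, `R(i,j,m)`, `jac₁(i,j,k,m)` and `jac₂(i,j,k,m)` of the free module. -/
def kerVec : KerIndex p n → FreeMod p n
  | .rPow i m _ => monX p m • eP p i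
  | .rPowLt i j h m _ _ _ =>
      monX p m • eP p i -
        (varX p i ^ (p - 1) * varX p j ^ ((m j : ℕ) - 1) *
          ∏ s ∈ univ \ {i, j}, varX p s ^ (m s : ℕ)) • eC p h
  | .rPowGt i j h m _ _ _ =>
      monX p m • eP p i +
        (varX p i ^ (p - 1) * varX p j ^ ((m j : ℕ) - 1) *
          ∏ s ∈ univ \ {i, j}, varX p s ^ (m s : ℕ)) • eC p h
  | .rComm i j h m _ =>
      (varX p j ^ (p - 1) * varX p i ^ (p - 1) * monX p m) • eC p h
  | .jac₁ i j k hij hjk m _ _ =>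
      (monX p m * varX p k) • eC p hij + (monX p m * varX p i) • eC p hjk
        - (monX p m * varX p j) • eC p (hij.trans hjk)
  | .jac₂ i j k hij hjk m _ _ =>
      (monX p m * varX p k ^ (p - 1) * varX p j) • eC p (hij.trans hjk)
        - (monX p m * varX p k ^ (p - 1) * varX p i) • eC p hjk

variable (n)

/-- The index set of the family `baseVec`. -/
inductive BaseIndex : Type
  | pow (i : Fin n)
  | comm (i j : Fin n) (h : i < j) (ν : Fin n → Fin p)
      (hmax : ∀ s, (ν s : ℕ) ≠ 0 → s ≤ j)
      (hne : (ν i : ℕ) ≠ p - 1 ∨ (ν j : ℕ) ≠ p - 1)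
      (hmid : (ν j : ℕ) = p - 1 → ∀ k, i < k → k < j → (ν k : ℕ) = 0)

variable {n}

/-- The vectors `xᵢᵖ` and `(xᵢ, xⱼ) X^ν` of `Mₙ`. -/
def baseVec : BaseIndex p n → ModM p n
  | .pow i => powClass p i
  | .comm i j _ ν _ _ _ => monX p ν • commClass p i j

end FreeModule

end

/-! The theorem comes down to one spanning statement and one independence statement. The commutator
identity (ab,d) = (a,d)^b (b,d), read modulo Φ⁽²⁾, puts the defining relations into ker ψ
(`psi_eq_zero_of_defRel`), and every kernel vector is a consequence of them over the group algebra
(`kerVec_mem`). Used as rewriting rules, the kernel vectors turn each monomial multiple of a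
generator into a combination of lifts of the proposed basis of Mₙ. So kernel vectors and lifts
together span the free module over 𝐅ₚ (`kerBaseSpan_eq_top`).

Independence in Mₙ comes from the Magnus homomorphism. Sending xᵢ to the pair (class of xᵢ, εᵢ) in
the semidirect product of Eₙ and (𝐅ₚEₙ)ⁿ induces a linear map on Mₙ with xᵢᵖ ↦ Xᵢ^(p-1) εᵢ and
(xᵢ,xⱼ) ↦ Xⱼ εᵢ - Xᵢ εⱼ. The images of the proposed basis vectors are triangular with respect to
suitable leading monomials (`linearIndependent_baseVec`); injectivity of the map is not needed.

Now write an element of ker ψ as a combination of kernel vectors plus a combination of lifts.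
Applying ψ kills the first summand, and independence in Mₙ kills the second. Hence the kernel
vectors span ker ψ over 𝐅ₚ, and the relations generate it. The kernel vectors are independent by
counting: the combined family spans, and its index set injects into the monomial basis of the free
module (`leadTermFin_injective`).

Surjectivity is topological: any closed normal subgroup containing all xᵢᵖ and (xᵢ,xⱼ) contains Φ
(`ker_proExpVec_le`, `ker_proExpVec`), and the preimage of the range of ψ is such a subgroup. -/

/-! ### Approximation in the free pro-`p` group and finite `p`-quotients -/

namespace PowIndexNormal

variable {p n : ℕ}

/-- The kernel of a homomorphism from the free group to a finite `p`-group. -/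
def ofHom [Fact p.Prime] {G : Type*} [Group G] (f : FreeGroup (Fin n) →* G)
    (hG : ∃ k, Nat.card G = p ^ k) : PowIndexNormal p n where
  toSubgroup := f.ker
  normal := inferInstance
  index_eq := by
    obtain ⟨k, hk⟩ := hG
    rw [Subgroup.index_ker]
    have h : Nat.card f.range ∣ p ^ k := hk ▸ Subgroup.card_subgroup_dvd_card f.range
    obtain ⟨j, _, hj⟩ := (Nat.dvd_prime_pow Fact.out).1 h
    exact ⟨j, hj⟩

/-- The intersection of two normal subgroups of `p`-power index. -/
def inter [Fact p.Prime] (N K : PowIndexNormal p n) : PowIndexNormal p n :=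
  ofHom ((QuotientGroup.mk' N.toSubgroup).prod (QuotientGroup.mk' K.toSubgroup)) (by
    obtain ⟨a, ha⟩ := N.index_eq
    obtain ⟨b, hb⟩ := K.index_eq
    refine ⟨a + b, ?_⟩
    rw [Nat.card_prod, pow_add, ← ha, ← hb]
    rfl)

theorem inter_le_left [Fact p.Prime] (N K : PowIndexNormal p n) :
    (N.inter K).toSubgroup ≤ N.toSubgroup := by
  intro w hw
  have h := (MonoidHom.mem_ker).1 hw
  exact (QuotientGroup.eq_one_iff w).1 (congrArg Prod.fst h)

theorem inter_le_right [Fact p.Prime] (N K : PowIndexNormal p n) :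
    (N.inter K).toSubgroup ≤ K.toSubgroup := by
  intro w hw
  have h := (MonoidHom.mem_ker).1 hw
  exact (QuotientGroup.eq_one_iff w).1 (congrArg Prod.snd h)

instance : Nonempty (PowIndexNormal p n) :=
  ⟨⟨⊤, inferInstance, 0, by simp⟩⟩

end PowIndexNormal

namespace FreeProP

variable {p n : ℕ}

/-- The canonical map from the discrete free group. -/
def ofFree (p n : ℕ) : FreeGroup (Fin n) →* FreeProP p n := FreeGroup.lift (gen p)

@[simp]
theorem ofFree_of (i : Fin n) : ofFree p n (FreeGroup.of i) = gen p i :=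
  FreeGroup.lift_apply_of

theorem proj_ofFree (N : PowIndexNormal p n) (w : FreeGroup (Fin n)) :
    proj N (ofFree p n w) = QuotientGroup.mk' N.toSubgroup w := by
  suffices h : (proj N).comp (ofFree p n) = QuotientGroup.mk' N.toSubgroup from
    DFunLike.congr_fun h w
  ext i
  rw [MonoidHom.comp_apply, ofFree_of]
  rfl

theorem proj_eq_of_le {N K : PowIndexNormal p n} (h : N.toSubgroup ≤ K.toSubgroup)
    {g g' : FreeProP p n} (hg : proj N g = proj N g') : proj K g = proj K g' := by
  have h1 : QuotientGroup.map N.toSubgroup K.toSubgroup (MonoidHom.id _) h (proj N g) = proj K g :=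
    g.2 N K h
  have h2 : QuotientGroup.map N.toSubgroup K.toSubgroup (MonoidHom.id _) h (proj N g') =
    proj K g' := g'.2 N K h
  rw [← h1, ← h2, hg]

theorem exists_ofFree_proj_eq (N : PowIndexNormal p n) (g : FreeProP p n) :
    ∃ w, proj N (ofFree p n w) = proj N g := by
  obtain ⟨w, hw⟩ := QuotientGroup.mk'_surjective N.toSubgroup (proj N g)
  exact ⟨w, by rw [proj_ofFree, hw]⟩

theorem isClosed_proj_preimage (N : PowIndexNormal p n)
    (T : Set (FreeGroup (Fin n) ⧸ N.toSubgroup)) : IsClosed (proj N ⁻¹' T) := by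
  let t : TopologicalSpace (FreeGroup (Fin n) ⧸ N.toSubgroup) := ⊥
  have _ : DiscreteTopology (FreeGroup (Fin n) ⧸ N.toSubgroup) := ⟨rfl⟩
  have hc : Continuous (proj N) := continuous_iInf_dom (i := N) continuous_induced_dom
  exact (isClosed_discrete T).preimage hc

theorem hasBasis_nhds [Fact p.Prime] (g : FreeProP p n) :
    (nhds g).HasBasis (fun _ : PowIndexNormal p n => True)
      (fun N => {h | proj N h = proj N g}) := by
  have h1 : nhds g = ⨅ N : PowIndexNormal p n, Filter.principal {h | proj N h = proj N g} := by
    rw [show nhds g = _ from nhds_iInf]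
    refine iInf_congr fun N => ?_
    let t : TopologicalSpace (FreeGroup (Fin n) ⧸ N.toSubgroup) := ⊥
    have _ : DiscreteTopology (FreeGroup (Fin n) ⧸ N.toSubgroup) := ⟨rfl⟩
    rw [nhds_induced, nhds_discrete, Filter.comap_pure]
    rfl
  rw [h1]
  refine Filter.hasBasis_iInf_principal ?_
  intro N K
  exact ⟨N.inter K, fun h hh => proj_eq_of_le (N.inter_le_left K) hh,
    fun h hh => proj_eq_of_le (N.inter_le_right K) hh⟩

/-- The fibres of the projections are a neighbourhood basis, so membership in a closed set can be
tested in each finite quotient separately. -/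
theorem mem_of_isClosed [Fact p.Prime] {C : Set (FreeProP p n)} (hC : IsClosed C)
    {g : FreeProP p n} (h : ∀ N : PowIndexNormal p n, ∃ s ∈ C, proj N s = proj N g) : g ∈ C := by
  rw [← hC.closure_eq, mem_closure_iff_nhds_basis (hasBasis_nhds g)]
  intro N _
  obtain ⟨s, hs, hg⟩ := h N
  exact ⟨s, hs, hg⟩

/-! ### Extension of homomorphisms into finite `p`-groups -/

section Lift

variable [Fact p.Prime] {G : Type*} [Group G] (f : FreeGroup (Fin n) →* G)
  (hG : ∃ k, Nat.card G = p ^ k)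

/-- The extension to the free pro-`p` group of a homomorphism from the free group to a finite
`p`-group. -/
def lift : FreeProP p n →* G :=
  (QuotientGroup.lift (PowIndexNormal.ofHom f hG).toSubgroup f fun _ hw => hw).comp
    (proj (PowIndexNormal.ofHom f hG))

theorem lift_ofFree (w : FreeGroup (Fin n)) : lift f hG (ofFree p n w) = f w := by
  rw [lift, MonoidHom.comp_apply, proj_ofFree]
  rfl

@[simp]
theorem lift_gen (i : Fin n) : lift f hG (gen p i) = f (FreeGroup.of i) := by
  rw [← ofFree_of, lift_ofFree]

theorem isClosed_lift_preimage (T : Set G) : IsClosed (lift f hG ⁻¹' T) :=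
  isClosed_proj_preimage (PowIndexNormal.ofHom f hG) 
    (QuotientGroup.lift (PowIndexNormal.ofHom f hG).toSubgroup f (fun _ hw => hw) ⁻¹' T)

/-- The discrete kernel is dense in the kernel of the extension: an approximation of `g` modulo the
intersection of `N` with `f.ker` agrees with `g` at `N` and itself lies in `f.ker`. -/
theorem ker_lift_le {H : Subgroup (FreeProP p n)} (hH : IsClosed (H : Set (FreeProP p n)))
    (h : ∀ w ∈ f.ker, ofFree p n w ∈ H) : (lift f hG).ker ≤ H := by
  intro g hg
  refine mem_of_isClosed hH fun N => ?_
  obtain ⟨w, hw⟩ := exists_ofFree_proj_eq (N.inter (PowIndexNormal.ofHom f hG)) g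
  refine ⟨_, h w ?_, proj_eq_of_le (N.inter_le_left _) hw⟩
  have h1 := proj_eq_of_le (N.inter_le_right (PowIndexNormal.ofHom f hG)) hw
  rw [MonoidHom.mem_ker, ← lift_ofFree f hG, lift, MonoidHom.comp_apply, h1]
  exact hg

/-- A homomorphism to a finite `p`-group kills `Φ(H)` if it maps `H` to an abelian subgroup of
exponent `p`. -/
theorem frattiniOf_le_ker_lift {H : Subgroup (FreeProP p n)}
    (hpow : ∀ a ∈ H, lift f hG a ^ p = 1)
    (hcomm : ∀ a ∈ H, ∀ b ∈ H, Commute (lift f hG a) (lift f hG b)) :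
    frattiniOf p H ≤ (lift f hG).ker := by
  refine Subgroup.topologicalClosure_minimal _ ?_ (isClosed_lift_preimage f hG {1})
  rw [Subgroup.closure_le]
  rintro g (⟨a, ha, rfl⟩ | ⟨a, ha, b, hb, rfl⟩)
  · simpa [MonoidHom.mem_ker] using hpow a ha
  · have h := (hcomm a ha b hb).eq
    simp only [SetLike.mem_coe, MonoidHom.mem_ker, map_mul, map_inv]
    rw [mul_assoc, h]
    group

end Lift

end FreeProP

/-! ### The Frattini quotient of the free pro-`p` group -/

section FrattiniQuotient

variable (p n : ℕ)

/-- The exponent vector modulo `p` of an element of the free group. -/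
def expVec : FreeGroup (Fin n) →* Multiplicative (Fin n → ZMod p) :=
  FreeGroup.lift fun i => Multiplicative.ofAdd (Pi.single i 1)

/-- The `p`-th powers and the commutators of the free generators. -/
def powCommSet : Set (FreeGroup (Fin n)) :=
  Set.range (fun i => FreeGroup.of i ^ p) ∪
    Set.range fun q : Fin n × Fin n =>
      (FreeGroup.of q.1)⁻¹ * (FreeGroup.of q.2)⁻¹ * FreeGroup.of q.1 * FreeGroup.of q.2

variable {n} in
/-- The exponent of the generator `i`. -/
def expHom (i : Fin n) : FreeGroup (Fin n) →* Multiplicative ℤ :=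
  FreeGroup.lift fun j => Multiplicative.ofAdd (if j = i then 1 else 0)

variable {p n}

theorem expVec_apply (w : FreeGroup (Fin n)) (i : Fin n) :
    (expVec p n w).toAdd i = ((expHom i w).toAdd : ZMod p) := by
  let c : Multiplicative ℤ →* Multiplicative (ZMod p) :=
    AddMonoidHom.toMultiplicative (Int.castAddHom (ZMod p))
  let e : Multiplicative (Fin n → ZMod p) →* Multiplicative (ZMod p) :=
    AddMonoidHom.toMultiplicative (Pi.evalAddMonoidHom (fun _ => ZMod p) i)
  have h : e.comp (expVec p n) = c.comp (expHom i) := by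
    ext j
    simp only [MonoidHom.comp_apply, expVec, expHom, FreeGroup.lift_apply_of]
    change (Pi.single j 1 : Fin n → ZMod p) i = ((if j = i then 1 else 0 : ℤ) : ZMod p)
    rw [Pi.single_apply]
    simp [eq_comm]
  exact DFunLike.congr_fun h w

theorem map_eq_prod_zpow {Q : Type*} [CommGroup Q] (f : FreeGroup (Fin n) →* Q)
    (w : FreeGroup (Fin n)) : f w = ∏ i, f (FreeGroup.of i) ^ (expHom i w).toAdd := by
  let g : FreeGroup (Fin n) →* Q :=
    ∏ i, (zpowersHom Q (f (FreeGroup.of i))).comp (expHom i)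
  have h : f = g := by
    ext j
    simp only [g, MonoidHom.finsetProd_apply, MonoidHom.comp_apply, expHom,
      FreeGroup.lift_apply_of, zpowersHom_apply, toAdd_ofAdd]
    rw [Finset.prod_eq_single j] <;> simp +contextual [eq_comm]
  conv_lhs => rw [h]
  simp [g]

/-- Modulo the normal closure the generators commute and have order dividing `p`. The quotient is
then abelian, and the image of a word depends only on its exponents modulo `p`. -/
theorem ker_expVec_le : (expVec p n).ker ≤ Subgroup.normalClosure (powCommSet p n) := by
  intro w hw
  set K := Subgroup.normalClosure (powCommSet p n) with hK
  have hpow : ∀ i, (QuotientGroup.mk' K (FreeGroup.of i)) ^ p = 1 := fun i => by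
    rw [← map_pow]
    exact (QuotientGroup.eq_one_iff _).2 (Subgroup.subset_normalClosure (Or.inl ⟨i, rfl⟩))
  have hcomm : ∀ i j, Commute (QuotientGroup.mk' K (FreeGroup.of i))
      (QuotientGroup.mk' K (FreeGroup.of j)) := fun i j => by
    have h : QuotientGroup.mk' K
        ((FreeGroup.of j)⁻¹ * (FreeGroup.of i)⁻¹ * FreeGroup.of j * FreeGroup.of i) = 1 :=
      (QuotientGroup.eq_one_iff _).2 (Subgroup.subset_normalClosure (Or.inr ⟨(j, i), rfl⟩))
    simp only [map_mul, map_inv] at h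
    rw [commute_iff_eq, ← mul_one (_ * _), ← h]
    group
  have hcomm1 : ∀ (v : FreeGroup (Fin n)) (j), Commute (QuotientGroup.mk' K v)
      (QuotientGroup.mk' K (FreeGroup.of j)) := fun v j => by
    induction v using FreeGroup.induction_on with
    | C1 => simp
    | of i => exact hcomm i j
    | inv_of i h => rw [map_inv]; exact h.inv_left
    | mul x y hx hy => rw [map_mul]; exact hx.mul_left hy
  have hcomm2 : ∀ v u : FreeGroup (Fin n), Commute (QuotientGroup.mk' K v)
      (QuotientGroup.mk' K u) := fun v u => by
    induction u using FreeGroup.induction_on with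
    | C1 => simp
    | of i => exact hcomm1 v i
    | inv_of i h => rw [map_inv]; exact h.inv_right
    | mul x y hx hy => rw [map_mul]; exact hx.mul_right hy
  let _ : CommGroup (FreeGroup (Fin n) ⧸ K) :=
    { (inferInstance : Group (FreeGroup (Fin n) ⧸ K)) with
      mul_comm := by
        intro a b
        obtain ⟨v, rfl⟩ := QuotientGroup.mk'_surjective K a
        obtain ⟨u, rfl⟩ := QuotientGroup.mk'_surjective K b
        exact hcomm2 v u }
  refine (QuotientGroup.eq_one_iff w).1 ?_
  change QuotientGroup.mk' K w = 1
  refine (map_eq_prod_zpow (QuotientGroup.mk' K) w).trans (Finset.prod_eq_one fun i _ => ?_)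
  have h1 : ((expHom i w).toAdd : ZMod p) = 0 := by
    rw [← expVec_apply, MonoidHom.mem_ker.1 hw]
    rfl
  obtain ⟨c, hc⟩ := (ZMod.intCast_zmod_eq_zero_iff_dvd _ _).1 h1
  rw [hc, zpow_mul, zpow_natCast]
  exact (congrArg (· ^ c) (hpow i)).trans (one_zpow c)

variable (p n) in
theorem card_expVec_codomain [NeZero p] :
    ∃ k, Nat.card (Multiplicative (Fin n → ZMod p)) = p ^ k :=
  ⟨n, by simp [Nat.card_eq_fintype_card, ZMod.card]⟩

variable [Fact p.Prime]

variable (p n) in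
/-- The exponent vector modulo `p` of an element of the free pro-`p` group. -/
def proExpVec : FreeProP p n →* Multiplicative (Fin n → ZMod p) :=
  FreeProP.lift (expVec p n) (card_expVec_codomain p n)

theorem proExpVec_gen (i : Fin n) :
    proExpVec p n (FreeProP.gen p i) = Multiplicative.ofAdd (Pi.single i 1) := by
  rw [proExpVec, FreeProP.lift_gen, expVec, FreeGroup.lift_apply_of]

/-- This minimality serves twice: with H = Φ it identifies the kernel with Φ, and with the preimage
of the range of ψ it gives surjectivity. -/
theorem ker_proExpVec_le {H : Subgroup (FreeProP p n)} [H.Normal]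
    (hH : IsClosed (H : Set (FreeProP p n))) (hpow : ∀ i, FreeProP.gen p i ^ p ∈ H)
    (hcomm : ∀ i j, (FreeProP.gen p i)⁻¹ * (FreeProP.gen p j)⁻¹ * FreeProP.gen p i *
      FreeProP.gen p j ∈ H) : (proExpVec p n).ker ≤ H := by
  refine FreeProP.ker_lift_le _ _ hH fun w hw => ?_
  have h : Subgroup.normalClosure (powCommSet p n) ≤ H.comap (FreeProP.ofFree p n) := by
    refine Subgroup.normalClosure_le_normal ?_
    rintro _ (⟨i, rfl⟩ | ⟨q, rfl⟩)
    · simpa using hpow i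
    · simpa using hcomm q.1 q.2
  exact h (ker_expVec_le hw)

theorem isClosed_frattiniOf {G : Type*} [Group G] [TopologicalSpace G] [IsTopologicalGroup G]
    (p : ℕ) (H : Subgroup G) : IsClosed (frattiniOf p H : Set G) :=
  Subgroup.isClosed_topologicalClosure _

variable (p n) in
theorem ker_proExpVec : (proExpVec p n).ker = Phi p (FreeProP p n) := by
  apply le_antisymm
  · exact ker_proExpVec_le (isClosed_frattiniOf _ _)
      (fun i => pow_mem_frattiniOf p (Subgroup.mem_top _))
      (fun i j => comm_mem_frattiniOf p (Subgroup.mem_top _) (Subgroup.mem_top _))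
  · refine FreeProP.frattiniOf_le_ker_lift _ _ (fun a _ => ?_) fun a _ b _ => Commute.all _ _
    apply Multiplicative.toAdd.injective
    rw [toAdd_pow, toAdd_one]
    ext i
    simp

theorem ofAdd_eq_prod (a : Fin n → ZMod p) :
    Multiplicative.ofAdd a =
      ∏ i, (proExpVec p n (FreeProP.gen p i)) ^ (a i).val := by
  apply Multiplicative.toAdd.injective
  ext j
  simp only [proExpVec_gen, toAdd_prod, toAdd_pow, toAdd_ofAdd, Finset.sum_apply, Pi.smul_apply,
    Pi.single_apply]
  simp

variable (p n) in
/-- The Frattini quotient is `𝐅ₚⁿ`. -/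
noncomputable def frattiniQuotientEquiv :
    FrattiniQuotient p (FreeProP p n) ≃* Multiplicative (Fin n → ZMod p) :=
  (QuotientGroup.quotientMulEquivOfEq (ker_proExpVec p n).symm).trans
    (QuotientGroup.quotientKerEquivOfSurjective (proExpVec p n) (by
      intro a
      -- The free pro-`p` group is not commutative, so the preimage is a product in a fixed order.
      refine ⟨((List.finRange n).map
        fun i => FreeProP.gen p i ^ (a.toAdd i).val).prod, ?_⟩
      conv_rhs => rw [← ofAdd_toAdd a, ofAdd_eq_prod, ← List.prod_ofFn, List.ofFn_eq_map]
      rw [map_list_prod, List.map_map]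
      simp [Function.comp_def]))

theorem frattiniQuotientEquiv_mk (g : FreeProP p n) :
    frattiniQuotientEquiv p n (FrattiniQuotient.mk p _ g) = proExpVec p n g := rfl

theorem frattiniQuotient_eq_prod (e : FrattiniQuotient p (FreeProP p n)) :
    e = ∏ i, FrattiniQuotient.mk p _ (FreeProP.gen p i) ^
      ((frattiniQuotientEquiv p n e).toAdd i).val := by
  apply (frattiniQuotientEquiv p n).injective
  simp only [map_prod, map_pow, frattiniQuotientEquiv_mk]
  rw [← ofAdd_eq_prod, ofAdd_toAdd]

instance : Finite (FrattiniQuotient p (FreeProP p n)) :=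
  Finite.of_equiv _ (frattiniQuotientEquiv p n).symm.toEquiv

theorem card_frattiniQuotient : Nat.card (FrattiniQuotient p (FreeProP p n)) = p ^ n := by
  rw [Nat.card_congr (frattiniQuotientEquiv p n).toEquiv]
  simp [Nat.card_eq_fintype_card, ZMod.card]

end FrattiniQuotient

/-! ### Monomials in the group algebra -/

section Monomials

variable {p n : ℕ}

/-- The monomial `X^μ` for an arbitrary exponent vector. -/
noncomputable def monN (p : ℕ) {n : ℕ} (μ : Fin n → ℕ) : AlgE p n := ∏ s, varX p s ^ μ s

theorem monX_eq_monN (ν : Fin n → Fin p) : monX p ν = monN p fun s => (ν s : ℕ) := rfl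

theorem monN_mul (μ μ' : Fin n → ℕ) : monN p μ * monN p μ' = monN p (μ + μ') := by
  simp [monN, pow_add, Finset.prod_mul_distrib]

theorem monN_zero : monN p (0 : Fin n → ℕ) = 1 := by simp [monN]

theorem varX_pow_eq_monN (i : Fin n) (k : ℕ) : varX p i ^ k = monN p (Pi.single i k) := by
  rw [monN, Finset.prod_eq_single i]
  · simp
  · intro s _ hs
    simp [hs]
  · simp

theorem varX_eq_monN (i : Fin n) : varX p i = monN p (Pi.single i 1) := by
  rw [← varX_pow_eq_monN, pow_one]

theorem of_mk_gen (i : Fin n) : MonoidAlgebra.of (ZMod p) _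
    (FrattiniQuotient.mk p (FreeProP p n) (FreeProP.gen p i)) = varX p i + 1 := by
  simp [varX]

theorem FrattiniQuotient.pow_eq_one {G : Type*} [Group G] [TopologicalSpace G]
    [IsTopologicalGroup G] (e : FrattiniQuotient p G) : e ^ p = 1 := by
  obtain ⟨g, rfl⟩ := QuotientGroup.mk'_surjective (Phi p G) e
  exact (QuotientGroup.eq_one_iff (g ^ p)).2 (pow_mem_frattiniOf p (Subgroup.mem_top g))

variable [Fact p.Prime]

instance {G : Type*} [Group G] [TopologicalSpace G] [IsTopologicalGroup G] :
    CharP (FrattiniAlgebra p G) p :=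
  charP_of_injective_algebraMap (algebraMap (ZMod p) (FrattiniAlgebra p G)).injective p

theorem varX_pow_p (i : Fin n) : varX p i ^ p = 0 := by
  rw [varX, sub_pow_char, ← map_pow, FrattiniQuotient.pow_eq_one, map_one, one_pow, sub_self]

theorem varX_pow_of_le (i : Fin n) {k : ℕ} (hk : p ≤ k) : varX p i ^ k = 0 :=
  pow_eq_zero_of_le hk (varX_pow_p i)

theorem monN_eq_zero {μ : Fin n → ℕ} {s : Fin n} (h : p ≤ μ s) : monN p μ = 0 :=
  Finset.prod_eq_zero (Finset.mem_univ s) (varX_pow_of_le s h)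

/-- In R the element x - 1 may be a zero divisor (it is nilpotent for x = xᵢ), so the identity is
proved in 𝐅ₚ[X], where X - 1 cancels, and then evaluated. It is the source of every factor Xᵢ^(p-1).
-/
theorem geom_sum_eq_sub_one_pow {R : Type*} [CommRing R] [CharP R p] (x : R) :
    ∑ k ∈ Finset.range p, x ^ k = (x - 1) ^ (p - 1) := by
  have h : ∑ k ∈ Finset.range p, (Polynomial.X : Polynomial (ZMod p)) ^ k =
      (Polynomial.X - 1) ^ (p - 1) := by
    have h0 : (Polynomial.X - 1 : Polynomial (ZMod p)) ≠ 0 := Polynomial.X_sub_C_ne_zero 1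
    apply mul_right_cancel₀ h0
    rw [geom_sum_mul, ← pow_succ, Nat.sub_add_cancel (Fact.out : p.Prime).one_le, sub_pow_char,
      one_pow]
  let _ : Algebra (ZMod p) R := ZMod.algebra R p
  simpa using congrArg (Polynomial.aeval x) h

/-- The span is stable under multiplication by Xᵢ, because too large exponents give zero, hence also
under xᵢ = Xᵢ + 1. Every group element is a product of powers of the xᵢ. -/
theorem mem_span_monX (a : AlgE p n) :
    a ∈ Submodule.span (ZMod p) (Set.range (monX p : (Fin n → Fin p) → AlgE p n)) := by
  set S := Submodule.span (ZMod p) (Set.range (monX p : (Fin n → Fin p) → AlgE p n)) with hS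
  have hmon : ∀ μ : Fin n → ℕ, monN p μ ∈ S := fun μ => by
    by_cases h : ∃ s, p ≤ μ s
    · obtain ⟨s, hs⟩ := h
      rw [monN_eq_zero hs]
      exact zero_mem _
    · push Not at h
      exact Submodule.subset_span ⟨fun s => ⟨μ s, h s⟩, rfl⟩
  have hX : ∀ (i : Fin n), ∀ b ∈ S, varX p i * b ∈ S := fun i b hb => by
    induction hb using Submodule.span_induction with
    | mem x hx =>
      obtain ⟨ν, rfl⟩ := hx
      rw [monX_eq_monN, varX_eq_monN, monN_mul]
      exact hmon _
    | zero => simp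
    | add x y _ _ hx hy => rw [mul_add]; exact add_mem hx hy
    | smul c x _ hx => rw [mul_smul_comm]; exact S.smul_mem c hx
  have hg : ∀ (i : Fin n) (k : ℕ), ∀ b ∈ S, (varX p i + 1) ^ k * b ∈ S := fun i k => by
    induction k with
    | zero => simp
    | succ k ih =>
      intro b hb
      rw [pow_succ, mul_assoc]
      refine ih _ ?_
      rw [add_mul, one_mul]
      exact add_mem (hX i b hb) hb
  induction a using MonoidAlgebra.induction_on with
  | of e =>
    rw [frattiniQuotient_eq_prod e, map_prod]
    simp only [map_pow, of_mk_gen]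
    induction (Finset.univ : Finset (Fin n)) using Finset.induction_on with
    | empty => rw [Finset.prod_empty, ← monN_zero]; exact hmon _
    | insert i t hi ih => rw [Finset.prod_insert hi]; exact hg i _ _ ih
  | add x y hx hy => exact add_mem hx hy
  | smul c x hx => exact S.smul_mem c hx

variable (p n) in
theorem card_monomials :
    Fintype.card (Fin n → Fin p) = Module.finrank (ZMod p) (AlgE p n) := by
  have := Fintype.ofFinite (FrattiniQuotient p (FreeProP p n))
  rw [Module.finrank_eq_card_basis (MonoidAlgebra.basis (FrattiniQuotient p (FreeProP p n)) (ZMod p)),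
    ← Nat.card_eq_fintype_card, ← Nat.card_eq_fintype_card, card_frattiniQuotient]
  simp

variable (p n) in
/-- The monomial basis of the group algebra. -/
noncomputable def monBasis : Module.Basis (Fin n → Fin p) (ZMod p) (AlgE p n) :=
  basisOfTopLeSpanOfCardEqFinrank (monX p) (fun a _ => mem_span_monX a) (card_monomials p n)

@[simp]
theorem monBasis_apply (ν : Fin n → Fin p) : monBasis p n ν = monX p ν := by
  simp [monBasis]

/-- The coefficient of `X^μ`. -/
noncomputable def coordN (μ : Fin n → ℕ) : AlgE p n →ₗ[ZMod p] ZMod p :=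
  -- Vectors with an entry at least `p` get the zero functional, in accordance with `monN_eq_zero`;
  -- thus `coordN_of_ne` needs no bounds.
  if h : ∀ s, μ s < p then (monBasis p n).coord fun s => ⟨μ s, h s⟩ else 0

theorem coordN_self {μ : Fin n → ℕ} (h : ∀ s, μ s < p) : coordN μ (monN p μ) = 1 := by
  rw [coordN, dif_pos h]
  have h1 : monN p μ = monBasis p n fun s => ⟨μ s, h s⟩ := by
    rw [monBasis_apply]; rfl
  rw [h1, Module.Basis.coord_apply, Module.Basis.repr_self, Finsupp.single_eq_same]

theorem coordN_of_ne {μ μ' : Fin n → ℕ} (h : μ ≠ μ') : coordN μ (monN p μ') = 0 := by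
  by_cases h1 : ∀ s, μ s < p
  · by_cases h2 : ∀ s, μ' s < p
    · rw [coordN, dif_pos h1]
      have h3 : monN p μ' = monBasis p n fun s => ⟨μ' s, h2 s⟩ := by
        rw [monBasis_apply]; rfl
      rw [h3, Module.Basis.coord_apply, Module.Basis.repr_self, Finsupp.single_eq_of_ne]
      intro h4
      apply h
      ext s
      exact congrArg Fin.val (congrFun h4 s)
    · push Not at h2
      obtain ⟨s, hs⟩ := h2
      rw [monN_eq_zero hs, map_zero]
  · rw [coordN, dif_neg h1, LinearMap.zero_apply]

instance : Module.Finite (ZMod p) (AlgE p n) := .of_basis (monBasis p n)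

end Monomials

/-! ### Relations between commutators and powers modulo `Φ⁽²⁾` -/

section Relations

variable {p : ℕ} {G : Type*} [Group G] [TopologicalSpace G] [IsTopologicalGroup G]

variable (p) in
/-- The class of the commutator `(a, b)` in `M_G`. -/
def FrattiniModule.comm (a b : G) : FrattiniModule p G :=
  FrattiniModule.mk p G (.ofMul ⟨a⁻¹ * b⁻¹ * a * b,
    comm_mem_frattiniOf p (Subgroup.mem_top _) (Subgroup.mem_top _)⟩)

variable (p) in
/-- The group element `g` in the group algebra of the Frattini quotient. -/
noncomputable def FrattiniAlgebra.of (g : G) : FrattiniAlgebra p G :=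
  MonoidAlgebra.of (ZMod p) _ (FrattiniQuotient.mk p G g)

namespace FrattiniModule

theorem frattiniAlgebraOf_smul_mk (g : G) (α : Phi p G) :
    FrattiniAlgebra.of p g • mk p G (.ofMul α) = mk p G (.ofMul (Phi.conj g α)) := by
  rw [FrattiniAlgebra.of, of_smul, conj_mk]

theorem mk_mul (α β : Phi p G) :
    mk p G (.ofMul (α * β)) = mk p G (.ofMul α) + mk p G (.ofMul β) := by
  rw [ofMul_mul, map_add]

theorem comm_swap (a b : G) : comm p b a = -comm p a b := by
  rw [comm, comm, ← map_neg, ← ofMul_inv]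
  congr 3
  simp [mul_assoc]

theorem comm_self (a : G) : comm p a a = 0 := by
  rw [comm, ← map_zero (mk p G), ← ofMul_one]
  congr 3
  simp

theorem comm_mul_left (a b d : G) :
    comm p (a * b) d = FrattiniAlgebra.of p b • comm p a d + comm p b d := by
  rw [comm, comm, comm, frattiniAlgebraOf_smul_mk, ← mk_mul]
  congr 2
  ext
  simp only [Phi.conj_coe, Subgroup.coe_mul]
  group

theorem comm_coe_left (α : Phi p G) (d : G) :
    comm p (α : G) d = (FrattiniAlgebra.of p d - 1) • mk p G (.ofMul α) := by
  rw [sub_smul, one_smul, eq_sub_iff_add_eq, frattiniAlgebraOf_smul_mk, comm, add_comm, ← mk_mul]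
  congr 2
  ext
  simp only [Phi.conj_coe, Subgroup.coe_mul]
  group

theorem frattiniAlgebraOf_coe (α : Phi p G) : FrattiniAlgebra.of p (α : G) = 1 := by
  rw [FrattiniAlgebra.of, ← map_one (MonoidAlgebra.of (ZMod p) (FrattiniQuotient p G))]
  congr 1
  exact (QuotientGroup.eq_one_iff (α : G)).2 α.2

/-- Since ab = ba(a,b), the commutator (ab,d) can be expanded in two ways. The factor (a,b) lies in
Φ, so it acts trivially on M and contributes (a,b)·(d - 1). -/
theorem jacobi (a b d : G) :
    (FrattiniAlgebra.of p d - 1) • comm p a b + (FrattiniAlgebra.of p a - 1) • comm p b d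
      - (FrattiniAlgebra.of p b - 1) • comm p a d = 0 := by
  let α : Phi p G := ⟨a⁻¹ * b⁻¹ * a * b,
    comm_mem_frattiniOf p (Subgroup.mem_top _) (Subgroup.mem_top _)⟩
  have h1 : a * b = b * a * (α : G) := by simp [α, mul_assoc]
  have h2 := comm_mul_left (p := p) (b * a) (α : G) d
  rw [← h1, comm_mul_left, comm_mul_left, frattiniAlgebraOf_coe, one_smul, comm_coe_left,
    show mk p G (.ofMul α) = comm p a b from rfl] at h2
  simp only [sub_smul, one_smul] at h2 ⊢
  rw [← sub_eq_zero] at h2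
  rw [← neg_eq_zero, ← h2]
  abel

/-- Iterating `comm_mul_left` gives the factor 1 + a + ⋯ + a^(p-1), which is (a - 1)^(p-1) in
characteristic `p`. -/
theorem comm_pow_left [Fact p.Prime] (a d : G) :
    comm p (a ^ p) d = (FrattiniAlgebra.of p a - 1) ^ (p - 1) • comm p a d := by
  have h : ∀ m : ℕ, comm p (a ^ m) d =
      (∑ k ∈ Finset.range m, FrattiniAlgebra.of p a ^ k) • comm p a d := fun m => by
    induction m with
    | zero =>
      simp only [pow_zero, Finset.range_zero, Finset.sum_empty, zero_smul]
      have h1 := comm_mul_left (p := p) 1 1 d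
      rw [mul_one, FrattiniAlgebra.of, map_one, map_one, one_smul] at h1
      simpa using h1
    | succ m ih =>
      rw [pow_succ, comm_mul_left, ih, geom_sum_succ, add_smul, one_smul, mul_smul]
  rw [h, geom_sum_eq_sub_one_pow]

end FrattiniModule

end Relations

/-! ### The defining relations hold in `Mₙ` -/

section DefRel

variable {p n : ℕ}

theorem varX_eq (i : Fin n) : varX p i = FrattiniAlgebra.of p (FreeProP.gen p i) - 1 := rfl

theorem commClass_eq (i j : Fin n) :
    commClass p i j = FrattiniModule.comm p (FreeProP.gen p i) (FreeProP.gen p j) := rfl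

theorem jacobi_commClass (i j k : Fin n) :
    varX p k • commClass p i j + varX p i • commClass p j k - varX p j • commClass p i k = 0 :=
  FrattiniModule.jacobi _ _ _

@[simp]
theorem psi_eP (i : Fin n) : psi p n (eP p i) = powClass p i := by
  simp [psi, eP]

@[simp]
theorem psi_eC {i j : Fin n} (h : i < j) : psi p n (eC p h) = commClass p i j := by
  simp [psi, eC]

variable [Fact p.Prime]

/-- Both sides compute the class of (xᵢᵖ, xⱼ): once with xᵢᵖ as an element of Φ, once with it as a
`p`-th power. The first three families of relations are the cases i = j, i < j and i > j. -/
theorem varX_smul_powClass (i j : Fin n) :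
    varX p j • powClass p i = varX p i ^ (p - 1) • commClass p i j := by
  rw [varX_eq, varX_eq, commClass_eq, ← FrattiniModule.comm_pow_left, powClass,
    ← FrattiniModule.comm_coe_left]

theorem psi_eq_zero_of_defRel {r : FreeMod p n} (hr : DefRel p n r) : psi p n r = 0 := by
  cases hr with
  | powSelf i =>
    rw [map_smul, psi_eP, varX_smul_powClass, commClass_eq, FrattiniModule.comm_self, smul_zero]
  | powLt i j h =>
    rw [map_sub, map_smul, map_smul, psi_eP, psi_eC, varX_smul_powClass, sub_self]
  | powGt i j h =>
    rw [map_add, map_smul, map_smul, psi_eP, psi_eC, varX_smul_powClass, commClass_eq i j,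
      FrattiniModule.comm_swap, smul_neg, ← commClass_eq, neg_add_cancel]
  | jacobi i j k hij hjk =>
    simp only [map_sub, map_add, map_smul, psi_eC]
    exact jacobi_commClass i j k

theorem span_defRel_le_ker :
    Submodule.span (AlgE p n) {r | DefRel p n r} ≤ LinearMap.ker (psi p n) :=
  Submodule.span_le.2 fun _ hr => psi_eq_zero_of_defRel hr

end DefRel

/-! ### Surjectivity of ψ -/

section Surjective

variable {p n : ℕ} [Fact p.Prime]

/-- The elements of `Φ` whose class lies in a given submodule. -/
def submodulePreimage {G : Type*} [Group G] [TopologicalSpace G] [IsTopologicalGroup G]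
    (R : Submodule (FrattiniAlgebra p G) (FrattiniModule p G)) : Subgroup G where
  carrier := {g | ∃ h : g ∈ Phi p G, FrattiniModule.mk p G (.ofMul ⟨g, h⟩) ∈ R}
  mul_mem' := by
    rintro a b ⟨ha, ha'⟩ ⟨hb, hb'⟩
    refine ⟨mul_mem ha hb, ?_⟩
    have h := R.add_mem ha' hb'
    rwa [← FrattiniModule.mk_mul] at h
  one_mem' := ⟨one_mem _, by
    have h : FrattiniModule.mk p G (.ofMul 1) ∈ R := by
      rw [ofMul_one, map_zero]
      exact zero_mem _
    exact h⟩
  inv_mem' := by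
    rintro a ⟨ha, ha'⟩
    refine ⟨inv_mem ha, ?_⟩
    have h := R.neg_mem ha'
    rwa [← map_neg, ← ofMul_inv] at h

instance {G : Type*} [Group G] [TopologicalSpace G] [IsTopologicalGroup G]
    (R : Submodule (FrattiniAlgebra p G) (FrattiniModule p G)) :
    (submodulePreimage R).Normal where
  conj_mem := by
    rintro a ⟨ha, ha'⟩ g
    refine ⟨(Phi_normal p G).conj_mem a ha g, ?_⟩
    have h := R.smul_mem (FrattiniAlgebra.of p g⁻¹) ha'
    rw [FrattiniModule.frattiniAlgebraOf_smul_mk] at h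
    convert h using 3
    ext
    simp [Phi.conj_coe]

/-- The preimage is a finite union of cosets of the closed subgroup Φ⁽²⁾, one for each element of
`R`. -/
theorem isClosed_submodulePreimage {G : Type*} [Group G] [TopologicalSpace G]
    [IsTopologicalGroup G] (R : Submodule (FrattiniAlgebra p G) (FrattiniModule p G))
    (hR : (R : Set (FrattiniModule p G)).Finite) :
    IsClosed (submodulePreimage R : Set G) := by
  have h : (submodulePreimage R : Set G) = ⋃ r ∈ (R : Set (FrattiniModule p G)),
      {g | ∃ h : g ∈ Phi p G, FrattiniModule.mk p G (.ofMul ⟨g, h⟩) = r} := by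
    ext g
    simp only [Set.mem_iUnion, Set.mem_ofPred_eq, SetLike.mem_coe]
    constructor
    · rintro ⟨hg, hg'⟩
      exact ⟨_, hg', hg, rfl⟩
    · rintro ⟨r, hr, hg, rfl⟩
      exact ⟨hg, hr⟩
  rw [h]
  refine hR.isClosed_biUnion fun r _ => ?_
  obtain ⟨α, rfl⟩ := FrattiniModule.mk_surjective r
  obtain ⟨α, rfl⟩ := Additive.ofMul.surjective α
  have h1 : {g | ∃ h : g ∈ Phi p G, FrattiniModule.mk p G (.ofMul ⟨g, h⟩) =
      FrattiniModule.mk p G (.ofMul α)} = (fun g => g⁻¹ * (α : G)) ⁻¹' (PhiTwo p G : Set G) := by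
    ext g
    simp only [Set.mem_ofPred_eq, Set.mem_preimage, SetLike.mem_coe, FrattiniModule.mk_eq_mk]
    refine ⟨fun h => h.2, fun h => ⟨?_, h⟩⟩
    have h2 : g⁻¹ * (α : G) ∈ Phi p G := by
      refine (Subgroup.topologicalClosure_minimal _ ?_ (isClosed_frattiniOf p ⊤)) h
      rw [Subgroup.closure_le]
      rintro x (⟨a, ha, rfl⟩ | ⟨a, ha, b, hb, rfl⟩)
      · exact pow_mem ha p
      · exact mul_mem (mul_mem (mul_mem (inv_mem ha) (inv_mem hb)) ha) hb
    have h3 : g = (α : G) * (g⁻¹ * (α : G))⁻¹ := by group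
    rw [h3]
    exact mul_mem α.2 (inv_mem h2)
  rw [h1]
  exact (isClosed_frattiniOf p _).preimage (by fun_prop)

instance : Finite (AlgE p n) := Module.finite_of_finite (ZMod p)

instance : Finite (FreeMod p n) := Module.finite_of_finite (AlgE p n)

variable (p n) in
theorem psi_surjective : Function.Surjective (psi p n) := by
  have h : Phi p (FreeProP p n) ≤ submodulePreimage (LinearMap.range (psi p n)) := by
    rw [← ker_proExpVec]
    refine ker_proExpVec_le (isClosed_submodulePreimage _ ?_) (fun i => ⟨_, eP p i, psi_eP i⟩)
      fun i j => ?_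
    · rw [LinearMap.coe_range]
      exact Set.finite_range _
    · refine ⟨comm_mem_frattiniOf p (Subgroup.mem_top _) (Subgroup.mem_top _), ?_⟩
      change commClass p i j ∈ _
      rcases lt_trichotomy i j with hij | rfl | hij
      · exact ⟨eC p hij, psi_eC hij⟩
      · rw [commClass_eq, FrattiniModule.comm_self]
        exact zero_mem _
      · rw [commClass_eq, FrattiniModule.comm_swap]
        exact neg_mem ⟨eC p hij, psi_eC hij⟩
  intro m
  obtain ⟨α, rfl⟩ := FrattiniModule.mk_surjective m
  obtain ⟨α, rfl⟩ := Additive.ofMul.surjective α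
  exact (h α.2).2

end Surjective

/-! ### The Magnus embedding -/

section Magnus

variable (p n : ℕ)

/-- The semidirect product of `Eₙ` and `(𝐅ₚEₙ)ⁿ`, with `Eₙ` acting on the right. -/
@[ext]
structure MagnusGroup : Type where
  fst : FrattiniQuotient p (FreeProP p n)
  snd : Fin n → AlgE p n

namespace MagnusGroup

variable {p n}

/-- The underlying pair. -/
def equivProd : MagnusGroup p n ≃ FrattiniQuotient p (FreeProP p n) × (Fin n → AlgE p n) where
  toFun x := (x.fst, x.snd)
  invFun x := ⟨x.1, x.2⟩

noncomputable instance : Mul (MagnusGroup p n) :=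
  ⟨fun x y => ⟨x.fst * y.fst, MonoidAlgebra.of (ZMod p) _ y.fst • x.snd + y.snd⟩⟩

noncomputable instance : One (MagnusGroup p n) := ⟨⟨1, 0⟩⟩

noncomputable instance : Inv (MagnusGroup p n) :=
  ⟨fun x => ⟨x.fst⁻¹, -(MonoidAlgebra.of (ZMod p) _ x.fst⁻¹ • x.snd)⟩⟩

theorem mul_fst (x y : MagnusGroup p n) : (x * y).fst = x.fst * y.fst := rfl

theorem mul_snd (x y : MagnusGroup p n) :
    (x * y).snd = MonoidAlgebra.of (ZMod p) _ y.fst • x.snd + y.snd := rfl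

theorem one_fst : (1 : MagnusGroup p n).fst = 1 := rfl

theorem one_snd : (1 : MagnusGroup p n).snd = 0 := rfl

theorem inv_fst (x : MagnusGroup p n) : x⁻¹.fst = x.fst⁻¹ := rfl

theorem inv_snd (x : MagnusGroup p n) :
    x⁻¹.snd = -(MonoidAlgebra.of (ZMod p) _ x.fst⁻¹ • x.snd) := rfl

noncomputable instance : Group (MagnusGroup p n) :=
  Group.ofLeftAxioms
    (fun x y z => by
      ext1
      · simp only [mul_fst, mul_assoc]
      · simp only [mul_snd, mul_fst, smul_add, smul_smul, map_mul, add_assoc, mul_comm])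
    (fun x => by
      ext1
      · simp only [mul_fst, one_fst, one_mul]
      · simp only [mul_snd, one_snd, smul_zero, zero_add])
    (fun x => by
      ext1
      · simp only [mul_fst, inv_fst, one_fst, inv_mul_cancel]
      · simp only [mul_snd, inv_snd, one_snd, smul_neg, smul_smul, ← map_mul, mul_inv_cancel,
          map_one, one_smul, neg_add_cancel])

theorem pow_snd (x : MagnusGroup p n) (m : ℕ) :
    (x ^ m).snd = (∑ k ∈ Finset.range m, MonoidAlgebra.of (ZMod p) _ x.fst ^ k) • x.snd := by
  induction m with
  | zero => simp [one_snd]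
  | succ m ih => rw [pow_succ, mul_snd, ih, geom_sum_succ, add_smul, one_smul, mul_smul]

variable (p n) in
/-- The projection to `Eₙ`. -/
noncomputable def fstHom : MagnusGroup p n →* FrattiniQuotient p (FreeProP p n) where
  toFun := fst
  map_one' := rfl
  map_mul' _ _ := rfl

theorem mul_snd_of_fst_eq_one {x y : MagnusGroup p n} (hy : y.fst = 1) :
    (x * y).snd = x.snd + y.snd := by
  rw [mul_snd, hy, map_one, one_smul]

theorem pow_p_eq_one {x : MagnusGroup p n} (hx : x.fst = 1) : x ^ p = 1 := by
  ext1
  · exact (map_pow (fstHom p n) x p).trans (by rw [one_fst, FrattiniQuotient.pow_eq_one])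
  · rw [pow_snd, hx, one_snd]
    ext i
    simp

theorem commute_of_fst_eq_one {x y : MagnusGroup p n} (hx : x.fst = 1) (hy : y.fst = 1) :
    Commute x y := by
  rw [commute_iff_eq]
  ext1
  · rw [mul_fst, mul_fst, mul_comm]
  · rw [mul_snd_of_fst_eq_one hx, mul_snd_of_fst_eq_one hy, add_comm]

variable (p n) in
theorem card [Fact p.Prime] : ∃ k, Nat.card (MagnusGroup p n) = p ^ k := by
  rw [Nat.card_congr equivProd, Nat.card_prod, card_frattiniQuotient,
    Module.natCard_eq_pow_finrank (K := ZMod p), Nat.card_zmod, ← pow_add]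
  exact ⟨_, rfl⟩

end MagnusGroup

/-- The Magnus homomorphism on the discrete free group. -/
noncomputable def magnusHom : FreeGroup (Fin n) →* MagnusGroup p n :=
  FreeGroup.lift fun i => ⟨FrattiniQuotient.mk p _ (FreeProP.gen p i), Pi.single i 1⟩

-- A single word approximates `g` in two finite quotients at once. Thus identities between
-- homomorphisms to finite `p`-groups can be checked on the discrete free group.
variable {p n} in
theorem FreeProP.exists_lift_eq [Fact p.Prime] {G G' : Type*} [Group G] [Group G']
    (f : FreeGroup (Fin n) →* G) (hG : ∃ k, Nat.card G = p ^ k)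
    (f' : FreeGroup (Fin n) →* G') (hG' : ∃ k, Nat.card G' = p ^ k) (g : FreeProP p n) :
    ∃ w, lift f hG (ofFree p n w) = lift f hG g ∧ lift f' hG' (ofFree p n w) = lift f' hG' g := by
  obtain ⟨w, hw⟩ := exists_ofFree_proj_eq
    ((PowIndexNormal.ofHom f hG).inter (PowIndexNormal.ofHom f' hG')) g
  refine ⟨w, ?_, ?_⟩
  · rw [lift, MonoidHom.comp_apply, MonoidHom.comp_apply,
      proj_eq_of_le (PowIndexNormal.inter_le_left _ _) hw]
  · rw [lift, MonoidHom.comp_apply, MonoidHom.comp_apply,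
      proj_eq_of_le (PowIndexNormal.inter_le_right _ _) hw]

variable [Fact p.Prime]

/-- The Magnus homomorphism on the free pro-`p` group. -/
noncomputable def proMagnus : FreeProP p n →* MagnusGroup p n :=
  FreeProP.lift (magnusHom p n) (MagnusGroup.card p n)

variable {p n}

theorem proMagnus_gen (i : Fin n) : proMagnus p n (FreeProP.gen p i) =
    ⟨FrattiniQuotient.mk p _ (FreeProP.gen p i), Pi.single i 1⟩ := by
  rw [proMagnus, FreeProP.lift_gen, magnusHom, FreeGroup.lift_apply_of]

theorem proMagnus_fst (g : FreeProP p n) : (proMagnus p n g).fst = FrattiniQuotient.mk p _ g := by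
  obtain ⟨w, h1, h2⟩ := FreeProP.exists_lift_eq (magnusHom p n) (MagnusGroup.card p n)
    (expVec p n) (card_expVec_codomain p n) g
  have h3 : FrattiniQuotient.mk p _ (FreeProP.ofFree p n w) = FrattiniQuotient.mk p _ g :=
    (frattiniQuotientEquiv p n).injective h2
  have h4 : ((MagnusGroup.fstHom p n).comp (proMagnus p n)).comp (FreeProP.ofFree p n) =
      (FrattiniQuotient.mk p _).comp (FreeProP.ofFree p n) := by
    ext i
    simp only [MonoidHom.comp_apply, FreeProP.ofFree_of, proMagnus_gen]
    rfl
  rw [← h3, proMagnus, ← h1]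
  exact DFunLike.congr_fun h4 w

theorem proMagnus_fst_coe (α : Phi p (FreeProP p n)) : (proMagnus p n α).fst = 1 := by
  rw [proMagnus_fst]
  exact (QuotientGroup.eq_one_iff (α : FreeProP p n)).2 α.2

/-- Φ lands in the second factor of the semidirect product, which is elementary abelian. -/
theorem phiTwo_le_ker_proMagnus : PhiTwo p (FreeProP p n) ≤ (proMagnus p n).ker :=
  FreeProP.frattiniOf_le_ker_lift _ _
    (fun a ha => MagnusGroup.pow_p_eq_one (proMagnus_fst_coe ⟨a, ha⟩))
    fun a ha b hb => MagnusGroup.commute_of_fst_eq_one (proMagnus_fst_coe ⟨a, ha⟩)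
      (proMagnus_fst_coe ⟨b, hb⟩)

/-- The second component of the Magnus homomorphism on `Φ`. -/
noncomputable def phiMagnus : Phi p (FreeProP p n) →* Multiplicative (Fin n → AlgE p n) where
  toFun α := .ofAdd (proMagnus p n α).snd
  map_one' := by simp [MagnusGroup.one_snd]
  map_mul' α β := by
    rw [← ofAdd_add, Subgroup.coe_mul, map_mul,
      MagnusGroup.mul_snd_of_fst_eq_one (proMagnus_fst_coe β)]

variable (p n) in
/-- The additive map from `Mₙ` to `(𝐅ₚEₙ)ⁿ` induced by the Magnus homomorphism. -/
noncomputable def magnusAddHom : ModM p n →+ (Fin n → AlgE p n) :=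
  MonoidHom.toAdditiveLeft <| QuotientGroup.lift _ phiMagnus fun α hα => by
    have h := phiTwo_le_ker_proMagnus (Subgroup.mem_subgroupOf.1 hα)
    rw [MonoidHom.mem_ker] at h
    change Multiplicative.ofAdd (proMagnus p n α).snd = 1
    rw [h]
    rfl

variable (p n) in
/-- The linear map from `Mₙ` to `(𝐅ₚEₙ)ⁿ` induced by the Magnus homomorphism. -/
noncomputable def magnusMap : ModM p n →ₗ[AlgE p n] (Fin n → AlgE p n) :=
  { magnusAddHom p n with
    map_smul' := by
      intro a m
      change magnusAddHom p n (a • m) = a • magnusAddHom p n m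
      induction a using MonoidAlgebra.induction_on with
      | of e =>
        obtain ⟨g, rfl⟩ := QuotientGroup.mk'_surjective (Phi p (FreeProP p n)) e
        obtain ⟨α, rfl⟩ := FrattiniModule.mk_surjective m
        obtain ⟨α, rfl⟩ := Additive.ofMul.surjective α
        have h1 := FrattiniModule.frattiniAlgebraOf_smul_mk g α
        -- The form g · αᵍ = α · g avoids inverses; comparing second components leaves exactly the
        -- action of g.
        have h2 : proMagnus p n g * proMagnus p n (Phi.conj g α) =
            proMagnus p n α * proMagnus p n g := by
          rw [← map_mul, ← map_mul, Phi.conj_coe]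
          congr 1
          group
        have h3 := congrArg MagnusGroup.snd h2
        rw [MagnusGroup.mul_snd_of_fst_eq_one (proMagnus_fst_coe _), MagnusGroup.mul_snd,
          add_comm, add_right_cancel_iff, proMagnus_fst] at h3
        exact (congrArg (magnusAddHom p n) h1).trans h3
      | add x y hx hy => rw [add_smul, map_add, hx, hy, add_smul]
      | smul c x hx =>
        rw [smul_assoc, ZMod.map_smul, hx, smul_assoc] }

theorem magnusMap_powClass (i : Fin n) :
    magnusMap p n (powClass p i) = varX p i ^ (p - 1) • Pi.single i 1 := by
  change (proMagnus p n (FreeProP.gen p i ^ p)).snd = _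
  rw [map_pow, MagnusGroup.pow_snd, proMagnus_gen, geom_sum_eq_sub_one_pow]
  rfl

theorem magnusMap_commClass (i j : Fin n) : magnusMap p n (commClass p i j) =
    varX p j • Pi.single i 1 - varX p i • Pi.single j 1 := by
  have h1 : proMagnus p n (FreeProP.gen p j) * proMagnus p n (FreeProP.gen p i) *
      proMagnus p n ((FreeProP.gen p i)⁻¹ * (FreeProP.gen p j)⁻¹ * FreeProP.gen p i *
        FreeProP.gen p j) =
      proMagnus p n (FreeProP.gen p i) * proMagnus p n (FreeProP.gen p j) := by
    simp only [← map_mul]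
    congr 1
    group
  have h2 := congrArg MagnusGroup.snd h1
  rw [MagnusGroup.mul_snd_of_fst_eq_one (proMagnus_fst_coe ⟨_, comm_mem_frattiniOf p
    (Subgroup.mem_top _) (Subgroup.mem_top _)⟩), MagnusGroup.mul_snd, MagnusGroup.mul_snd,
    proMagnus_gen, proMagnus_gen, of_mk_gen, of_mk_gen] at h2
  change (proMagnus p n ((FreeProP.gen p i)⁻¹ * (FreeProP.gen p j)⁻¹ * FreeProP.gen p i *
        FreeProP.gen p j)).snd = _
  rw [← eq_sub_iff_add_eq'] at h2
  rw [h2]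
  simp only [add_smul, one_smul]
  abel

end Magnus

/-! ### Linear independence of the basis vectors of `Mₙ` -/

section Independence

/-- By strong induction on the rank: `f a` sees, besides `v a`, only vectors of smaller rank, whose
coefficients already vanish. -/
theorem linearIndependent_of_triangular {ι K V : Type*} [Field K] [AddCommGroup V] [Module K V]
    {v : ι → V} (f : ι → V →ₗ[K] K) (r : ι → ℕ) (hd : ∀ a, f a (v a) ≠ 0)
    (ht : ∀ a b, f a (v b) ≠ 0 → b = a ∨ r b < r a) : LinearIndependent K v := by
  rw [linearIndependent_iff]
  intro l hl
  have h : ∀ m a, r a = m → l a = 0 := fun m => by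
    induction m using Nat.strong_induction_on with
    | _ m ih =>
      intro a ha
      have h1 := congrArg (f a) hl
      rw [map_zero, Finsupp.apply_linearCombination, Finsupp.linearCombination_apply,
        Finsupp.sum_eq_single a] at h1
      · simpa [hd a] using h1
      · intro b _ hb
        by_cases h2 : f a (v b) = 0
        · simp [h2]
        · rcases ht a b h2 with h3 | h3
          · exact absurd h3 hb
          · rw [ih _ (ha ▸ h3) b rfl, zero_smul]
      · simp
  ext a
  exact h _ a rfl

variable {p n : ℕ}

theorem add_single_lt {ν : Fin n → Fin p} {j : Fin n} (hj : (ν j : ℕ) ≠ p - 1) (s : Fin n) :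
    ((fun s => (ν s : ℕ)) + Pi.single j 1 : Fin n → ℕ) s < p := by
  have h1 := (ν s).2
  by_cases hs : s = j
  · subst hs
    simp only [Pi.add_apply, Pi.single_eq_same]
    omega
  · simp only [Pi.add_apply, Pi.single_eq_of_ne hs]
    omega

theorem eq_of_add_single_eq {ν ν' : Fin n → Fin p} {j : Fin n}
    (h : ((fun s => (ν s : ℕ)) + Pi.single j 1 : Fin n → ℕ) =
      (fun s => (ν' s : ℕ)) + Pi.single j 1) : ν = ν' := by
  ext s
  exact congrFun (add_right_cancel h) s

theorem add_single_apply_of_ne (ν : Fin n → Fin p) {j s : Fin n} (h : s ≠ j) :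
    ((fun s => (ν s : ℕ)) + Pi.single j 1 : Fin n → ℕ) s = ν s := by
  simp [h]

theorem add_single_apply_self (ν : Fin n → Fin p) (j : Fin n) :
    ((fun s => (ν s : ℕ)) + Pi.single j 1 : Fin n → ℕ) j = ν j + 1 := by
  simp

variable [Fact p.Prime]

theorem lt_of_coordN_ne_zero {μ μ' : Fin n → ℕ} (h : coordN μ (monN p μ') ≠ 0) (s : Fin n) :
    μ s < p := by
  by_contra hs
  exact h (by rw [coordN, dif_neg fun h1 => hs (h1 s), LinearMap.zero_apply])

theorem eq_of_coordN_ne_zero {μ μ' : Fin n → ℕ} (h : coordN μ (monN p μ') ≠ 0) : μ = μ' := by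
  by_contra h1
  exact h (coordN_of_ne h1)

theorem magnusMap_comm_apply (i j k : Fin n) (ν : Fin n → Fin p) :
    magnusMap p n (monX p ν • commClass p i j) k =
      (if k = i then monN p ((fun s => (ν s : ℕ)) + Pi.single j 1) else 0) -
        if k = j then monN p ((fun s => (ν s : ℕ)) + Pi.single i 1) else 0 := by
  rw [map_smul, magnusMap_commClass, ← monN_mul, ← monN_mul, ← varX_eq_monN, ← varX_eq_monN,
    monX_eq_monN]
  simp only [Pi.smul_apply, Pi.sub_apply, Pi.single_apply, smul_eq_mul, mul_sub, mul_ite, mul_one,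
    mul_zero]

theorem magnusMap_pow_apply (i k : Fin n) :
    magnusMap p n (powClass p i) k = if k = i then monN p (Pi.single i (p - 1)) else 0 := by
  rw [magnusMap_powClass, varX_pow_eq_monN]
  simp only [Pi.smul_apply, Pi.single_apply, smul_eq_mul, mul_ite, mul_one, mul_zero]

/-- The coordinate and the exponent vector of the leading term of the Magnus image of a basis
vector of `Mₙ`. -/
def leadMagnus : BaseIndex p n → Fin n × (Fin n → ℕ)
  | .pow i => (i, Pi.single i (p - 1))
  | .comm i j _ ν _ _ _ =>
      -- The image of (xᵢ,xⱼ)X^ν is X^ν Xⱼ εᵢ - X^ν Xᵢ εⱼ. The first term vanishes exactly when νⱼ =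
      -- p - 1, and then the second one leads.
      if (ν j : ℕ) ≠ p - 1 then (i, (fun s => (ν s : ℕ)) + Pi.single j 1)
      else (j, (fun s => (ν s : ℕ)) + Pi.single i 1)

/-- The order in which the leading terms are compared. -/
def rankMagnus : BaseIndex p n → ℕ
  | .pow _ => 1
  | .comm _ j _ ν _ _ _ => if (ν j : ℕ) ≠ p - 1 then 0 else 1

/-- The coefficient of the leading term of a basis vector of `Mₙ`. -/
noncomputable def leadCoeff (a : BaseIndex p n) : ModM p n →ₗ[ZMod p] ZMod p :=
  coordN (leadMagnus a).2 ∘ₗ LinearMap.proj (leadMagnus a).1 ∘ₗ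
    (magnusMap p n).restrictScalars (ZMod p)

theorem leadCoeff_pow (a : BaseIndex p n) (i : Fin n)
    (h : leadCoeff a (baseVec p (.pow i)) ≠ 0) :
    (leadMagnus a).1 = i ∧ (leadMagnus a).2 = Pi.single i (p - 1) := by
  change coordN _ (magnusMap p n (powClass p i) _) ≠ 0 at h
  rw [magnusMap_pow_apply] at h
  split_ifs at h with h1
  · exact ⟨h1, eq_of_coordN_ne_zero h⟩
  · simp at h

theorem leadCoeff_comm (a : BaseIndex p n) (i j : Fin n) (hij : i < j) (ν : Fin n → Fin p)
    (h1 h2 h3) (h : leadCoeff a (baseVec p (.comm i j hij ν h1 h2 h3)) ≠ 0) :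
    (∀ s, (leadMagnus a).2 s < p) ∧
    (((leadMagnus a).1 = i ∧ (leadMagnus a).2 = (fun s => (ν s : ℕ)) + Pi.single j 1) ∨
      ((leadMagnus a).1 = j ∧ (leadMagnus a).2 = (fun s => (ν s : ℕ)) + Pi.single i 1)) := by
  change coordN _ (magnusMap p n (monX p ν • commClass p i j) _) ≠ 0 at h
  rw [magnusMap_comm_apply] at h
  split_ifs at h with h4 h5 h5
  · exact absurd (h4.symm.trans h5) hij.ne
  · rw [sub_zero] at h
    exact ⟨lt_of_coordN_ne_zero h, Or.inl ⟨h4, eq_of_coordN_ne_zero h⟩⟩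
  · rw [zero_sub, map_neg, neg_ne_zero] at h
    exact ⟨lt_of_coordN_ne_zero h, Or.inr ⟨h5, eq_of_coordN_ne_zero h⟩⟩
  · simp at h

theorem leadCoeff_self (a : BaseIndex p n) : leadCoeff a (baseVec p a) ≠ 0 := by
  cases a with
  | pow i =>
    change coordN _ (magnusMap p n (powClass p i) i) ≠ 0
    rw [magnusMap_pow_apply, if_pos rfl]
    refine (coordN_self fun s => ?_).trans_ne one_ne_zero
    have h := (Fact.out : p.Prime).pos
    by_cases hs : s = i
    · subst hs
      simp [leadMagnus, h]
    · simp [leadMagnus, h, hs]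
  | comm i j hij ν h1 h2 h3 =>
    change coordN _ (magnusMap p n (monX p ν • commClass p i j) _) ≠ 0
    rw [magnusMap_comm_apply]
    by_cases hj : (ν j : ℕ) ≠ p - 1
    · simp only [leadMagnus, if_pos hj, if_true, if_neg hij.ne, sub_zero]
      exact (coordN_self (add_single_lt hj)).trans_ne one_ne_zero
    · simp only [leadMagnus, if_neg hj, if_true, if_neg hij.ne', zero_sub, map_neg]
      rw [neg_ne_zero]
      exact (coordN_self (add_single_lt (h2.resolve_right hj))).trans_ne one_ne_zero

/-- The leading term determines the vector within its type. If νⱼ ≠ p - 1, then j is the largest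
variable of X^ν Xⱼ. If νⱼ = p - 1, then i is the largest variable below j in X^ν Xᵢ, since ν
vanishes strictly between. The only overlap left is with a nonleading term of a vector of rank 0,
seen from rank 1. -/
theorem leadCoeff_triangular (a b : BaseIndex p n) (h : leadCoeff a (baseVec p b) ≠ 0) :
    b = a ∨ rankMagnus b < rankMagnus a := by
  cases b with
  | pow i' =>
    obtain ⟨h1, h2⟩ := leadCoeff_pow a i' h
    cases a with
    | pow i => exact Or.inl (congrArg _ h1.symm)
    | comm i j hij ν hmax hne hmid =>
      by_cases hj : (ν j : ℕ) ≠ p - 1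
      · simp only [leadMagnus, if_pos hj] at h1 h2
        have h3 := congrFun h2 j
        rw [add_single_apply_self, Pi.single_eq_of_ne (h1 ▸ hij.ne')] at h3
        omega
      · simp only [leadMagnus, if_neg hj] at h1 h2
        have h3 := congrFun h2 i
        rw [add_single_apply_self, Pi.single_eq_of_ne (h1 ▸ hij.ne)] at h3
        omega
  | comm i' j' hij' ν' hmax' hne' hmid' =>
    obtain ⟨hlt, h⟩ := leadCoeff_comm a i' j' hij' ν' hmax' hne' hmid' h
    cases a with
    | pow i =>
      rcases h with ⟨h1, h2⟩ | ⟨h1, h2⟩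
      · have h3 := congrFun h2 j'
        have h4 : j' ≠ i := by rw [show i = i' from h1]; exact hij'.ne'
        simp only [leadMagnus] at h3
        rw [add_single_apply_self, Pi.single_eq_of_ne h4] at h3
        omega
      · have h3 := congrFun h2 i'
        have h4 : i' ≠ i := by rw [show i = j' from h1]; exact hij'.ne
        simp only [leadMagnus] at h3
        rw [add_single_apply_self, Pi.single_eq_of_ne h4] at h3
        omega
    | comm i j hij ν hmax hne hmid =>
      by_cases hj : (ν j : ℕ) ≠ p - 1
      · simp only [leadMagnus, if_pos hj] at h
        rcases h with ⟨rfl, h2⟩ | ⟨rfl, h2⟩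
        · rcases lt_trichotomy j j' with hlt | rfl | hlt
          · have h3 := congrFun h2 j'
            rw [add_single_apply_self, add_single_apply_of_ne _ hlt.ne'] at h3
            exact absurd (hmax j' (by omega)) hlt.not_ge
          · obtain rfl := eq_of_add_single_eq h2
            exact Or.inl rfl
          · have h3 := congrFun h2 j
            rw [add_single_apply_self, add_single_apply_of_ne _ hlt.ne'] at h3
            exact absurd (hmax' j (by omega)) hlt.not_ge
        · have h3 := congrFun h2 j
          rw [add_single_apply_self, add_single_apply_of_ne _ (hij'.trans hij).ne'] at h3
          exact absurd (hmax' j (by omega)) hij.not_ge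
      · simp only [leadMagnus, if_neg hj] at h hlt
        by_cases hj' : (ν' j' : ℕ) ≠ p - 1
        · exact Or.inr (by simp [rankMagnus, hj, hj'])
        rcases h with ⟨rfl, h2⟩ | ⟨rfl, h2⟩
        · have h3 := hlt j'
          rw [h2, add_single_apply_self] at h3
          omega
        · rcases lt_trichotomy i i' with hlt' | rfl | hlt'
          · have h3 := congrFun h2 i'
            rw [add_single_apply_self, add_single_apply_of_ne _ hlt'.ne'] at h3
            exact absurd (hmid (by omega) i' hlt' hij') (by omega)
          · obtain rfl := eq_of_add_single_eq h2
            exact Or.inl rfl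
          · have h3 := congrFun h2 i
            rw [add_single_apply_self, add_single_apply_of_ne _ hlt'.ne'] at h3
            exact absurd (hmid' (by omega) i hlt' hij) (by omega)

variable (p n) in
theorem linearIndependent_baseVec :
    LinearIndependent (ZMod p) (baseVec p : BaseIndex p n → ModM p n) :=
  linearIndependent_of_triangular leadCoeff rankMagnus leadCoeff_self leadCoeff_triangular

end Independence

/-! ### The vectors of the kernel -/

section KerVec

variable {p n : ℕ}

theorem monX_eq_varX_mul (m : Fin n → Fin p) {j : Fin n} (hj : (m j : ℕ) ≠ 0) :
    ∃ b, monX p m = b * varX p j := by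
  refine ⟨monN p (Function.update (fun s => (m s : ℕ)) j (m j - 1)), ?_⟩
  rw [monX_eq_monN, varX_eq_monN, monN_mul]
  congr 1
  ext s
  by_cases hs : s = j
  · subst hs
    simp only [Pi.add_apply, Function.update_self, Pi.single_eq_same]
    omega
  · simp [hs]

theorem monX_eq_varX_mul_prod (m : Fin n → Fin p) {i j : Fin n} (hij : i ≠ j)
    (hi : (m i : ℕ) = 0) (hj : (m j : ℕ) ≠ 0) :
    monX p m = varX p j * (varX p j ^ ((m j : ℕ) - 1) *
      ∏ s ∈ Finset.univ \ {i, j}, varX p s ^ (m s : ℕ)) := by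
  rw [← mul_assoc, ← pow_succ', Nat.sub_add_cancel (Nat.one_le_iff_ne_zero.2 hj), monX,
    ← Finset.prod_sdiff (Finset.subset_univ {i, j}), Finset.prod_pair hij, hi, pow_zero, one_mul,
    mul_comm]

variable (p) in
/-- The lifts to the free module of the basis vectors of `Mₙ`. -/
noncomputable def baseLift : BaseIndex p n → FreeMod p n
  | .pow i => eP p i
  | .comm _ _ h ν _ _ _ => monX p ν • eC p h

theorem psi_baseLift (a : BaseIndex p n) : psi p n (baseLift p a) = baseVec p a := by
  cases a with
  | pow i => exact psi_eP i
  | comm i j h ν _ _ _ => rw [baseLift, map_smul, psi_eC, baseVec]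

variable [Fact p.Prime]

theorem kerVec_mem (a : KerIndex p n) :
    kerVec p a ∈ Submodule.span (AlgE p n) {r | DefRel p n r} := by
  set K := Submodule.span (AlgE p n) {r | DefRel p n r} with hK
  have hrel : ∀ {r}, DefRel p n r → r ∈ K := fun hr => Submodule.subset_span hr
  cases a with
  | rPow i m hi =>
    obtain ⟨b, hb⟩ := monX_eq_varX_mul m hi
    rw [kerVec, hb, mul_smul]
    exact K.smul_mem _ (hrel (.powSelf i))
  | rPowLt i j h m hi hj hm =>
    have h1 := K.smul_mem (varX p j ^ ((m j : ℕ) - 1) *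
      ∏ s ∈ Finset.univ \ {i, j}, varX p s ^ (m s : ℕ)) (hrel (.powLt i j h))
    rw [kerVec, monX_eq_varX_mul_prod m h.ne hi hj]
    convert h1 using 1
    simp only [smul_sub, smul_smul]
    congr 2 <;> ring
  | rPowGt i j h m hi hj hm =>
    have h1 := K.smul_mem (varX p j ^ ((m j : ℕ) - 1) *
      ∏ s ∈ Finset.univ \ {i, j}, varX p s ^ (m s : ℕ)) (hrel (.powGt i j h))
    rw [kerVec, monX_eq_varX_mul_prod m h.ne' hi hj]
    convert h1 using 1
    simp only [smul_add, smul_smul]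
    congr 2 <;> ring
  | rComm i j h m hm =>
    -- The multiplier Xⱼ^(p-1) kills the term Xⱼ eᵢ of the relation because Xⱼᵖ = 0.
    have h1 := K.smul_mem (-(varX p j ^ (p - 1) * monX p m)) (hrel (.powLt i j h))
    have h2 : varX p j ^ (p - 1) * varX p j = 0 := by
      rw [← pow_succ, Nat.sub_add_cancel (Fact.out : p.Prime).one_le, varX_pow_p]
    rw [kerVec]
    convert h1 using 1
    rw [smul_sub, smul_smul, smul_smul, neg_mul, mul_right_comm _ _ (varX p j), h2, zero_mul, neg_zero, zero_smul,
      zero_sub, neg_mul, neg_smul, neg_neg, mul_right_comm]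
  | jac₁ i j k hij hjk m hk hm =>
    have h1 := K.smul_mem (monX p m) (hrel (.jacobi i j k hij hjk))
    rw [kerVec]
    simpa only [smul_sub, smul_add, smul_smul] using h1
  | jac₂ i j k hij hjk m hj hm =>
    -- Likewise X_k^(p-1) kills the term of the Jacobi relation containing X_k.
    have h1 := K.smul_mem (-(monX p m * varX p k ^ (p - 1))) (hrel (.jacobi i j k hij hjk))
    have h2 : varX p k ^ (p - 1) * varX p k = 0 := by
      rw [← pow_succ, Nat.sub_add_cancel (Fact.out : p.Prime).one_le, varX_pow_p]
    rw [kerVec]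
    convert h1 using 1
    simp only [smul_sub, smul_add, smul_smul, neg_mul, mul_assoc, h2, mul_zero, neg_smul, neg_zero,
      zero_smul]
    abel

variable (p n) in
/-- The span over `𝐅ₚ` of the kernel vectors and the lifted basis vectors. -/
noncomputable def kerBaseSpan : Submodule (ZMod p) (FreeMod p n) :=
  Submodule.span (ZMod p) (Set.range (Sum.elim (kerVec p) (baseLift p)))

theorem kerVec_mem_kerBaseSpan (a : KerIndex p n) : kerVec p a ∈ kerBaseSpan p n :=
  Submodule.subset_span ⟨Sum.inl a, rfl⟩

theorem baseLift_mem_kerBaseSpan (a : BaseIndex p n) : baseLift p a ∈ kerBaseSpan p n :=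
  Submodule.subset_span ⟨Sum.inr a, rfl⟩

theorem Fin.exists_last_of_exists {P : Fin n → Prop} (h : ∃ k, P k) :
    ∃ k, P k ∧ ∀ s, k < s → ¬P s := by
  classical
  obtain ⟨k, hk⟩ := h
  obtain ⟨b, hb, hb'⟩ := (Finset.univ.filter P).exists_max_image id ⟨k, by simpa using hk⟩
  refine ⟨b, by simpa using hb, fun s hs h => ?_⟩
  exact (hb' s (by simpa using h)).not_gt hs

theorem monN_smul_mem_of_lt {S : Submodule (ZMod p) (FreeMod p n)} {e : FreeMod p n}
    {μ : Fin n → ℕ} (h : (∀ s, μ s < p) → monN p μ • e ∈ S) : monN p μ • e ∈ S := by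
  by_cases h1 : ∀ s, μ s < p
  · exact h h1
  · push Not at h1
    obtain ⟨s, hs⟩ := h1
    rw [monN_eq_zero hs, zero_smul]
    exact zero_mem _

/-- Such a monomial gives a lift of a basis vector unless both exponents, at i and at j, are p - 1;
in that case it is one of the vectors R(i,j,m). -/
theorem monN_smul_eC_mem_of_normal {i j : Fin n} (hij : i < j) (μ : Fin n → ℕ)
    (hmax : ∀ s, j < s → μ s = 0) (hmid : μ j = p - 1 → ∀ s, i < s → s < j → μ s = 0) :
    monN p μ • eC p hij ∈ kerBaseSpan p n := by
  refine monN_smul_mem_of_lt fun hlt => ?_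
  by_cases h : μ i ≠ p - 1 ∨ μ j ≠ p - 1
  · exact baseLift_mem_kerBaseSpan (.comm i j hij (fun s => ⟨μ s, hlt s⟩)
      (fun s hs => not_lt.1 fun h1 => hs (hmax s h1)) h hmid)
  · push Not at h
    have hp := (Fact.out : p.Prime).pos
    have h1 := kerVec_mem_kerBaseSpan (.rComm i j hij
      (fun s => ⟨if s < i then μ s else 0, by split_ifs <;> simp [hlt, hp]⟩) (by
        intro s hs
        simp [hs.not_gt]) : KerIndex p n)
    convert h1 using 1
    rw [kerVec, monX_eq_monN, varX_pow_eq_monN, varX_pow_eq_monN, monN_mul, monN_mul]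
    congr 2
    ext s
    simp only [Pi.add_apply, Pi.single_apply]
    rcases lt_trichotomy s i with h2 | rfl | h2
    · simp [h2, h2.ne, (h2.trans hij).ne]
    · simp [hij.ne, h.1]
    · rcases lt_trichotomy s j with h3 | rfl | h3
      · simp [h2.not_gt, h2.ne', h3.ne, hmid h.2 s h2 h3]
      · simp [hij.not_gt, h2.ne', h.2]
      · simp [h2.not_gt, h2.ne', h3.ne', hmax s h3]

theorem kerVec_jac₁ (i j k : Fin n) (hij : i < j) (hjk : j < k) (m : Fin n → Fin p) (hk hm) :
    kerVec p (.jac₁ i j k hij hjk m hk hm) =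
      monN p ((fun s => (m s : ℕ)) + Pi.single k 1) • eC p hij +
        monN p ((fun s => (m s : ℕ)) + Pi.single i 1) • eC p hjk -
        monN p ((fun s => (m s : ℕ)) + Pi.single j 1) • eC p (hij.trans hjk) := by
  simp only [kerVec, monX_eq_monN, varX_eq_monN, monN_mul]

theorem kerVec_jac₂ (i j k : Fin n) (hij : i < j) (hjk : j < k) (m : Fin n → Fin p) (hj hm) :
    kerVec p (.jac₂ i j k hij hjk m hj hm) =
      monN p ((fun s => (m s : ℕ)) + Pi.single k (p - 1) + Pi.single j 1) •
        eC p (hij.trans hjk) -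
      monN p ((fun s => (m s : ℕ)) + Pi.single k (p - 1) + Pi.single i 1) • eC p hjk := by
  simp only [kerVec, monX_eq_monN, varX_pow_eq_monN]
  simp only [varX_eq_monN, monN_mul]

/-- If the exponent of X_k is p - 1 and some variable lies strictly between i and k, let j be the
last such variable. Then jac₂ trades e₍ᵢ,ₖ₎ for e₍ⱼ,ₖ₎, and no variable strictly between j and k
remains, so one step suffices. -/
theorem monN_smul_eC_mem_of_max {i k : Fin n} (hik : i < k) (μ : Fin n → ℕ)
    (hmax : ∀ s, k < s → μ s = 0) : monN p μ • eC p hik ∈ kerBaseSpan p n := by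
  by_cases hmid : μ k = p - 1 → ∀ s, i < s → s < k → μ s = 0
  · exact monN_smul_eC_mem_of_normal hik μ hmax hmid
  refine monN_smul_mem_of_lt fun hlt => ?_
  push Not at hmid
  obtain ⟨hk, s, his, hsk, hs⟩ := hmid
  obtain ⟨j, ⟨hij, hjk, hj⟩, hlast⟩ := Fin.exists_last_of_exists
    (P := fun s => i < s ∧ s < k ∧ μ s ≠ 0) ⟨s, his, hsk, hs⟩
  have hp := (Fact.out : p.Prime).pos
  have hltj := hlt j
  have hzero : ∀ s, j < s → s ≠ k → μ s = 0 := fun s h1 h2 => by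
    by_contra h3
    rcases lt_or_gt_of_ne h2 with h4 | h4
    · exact hlast s h1 ⟨hij.trans h1, h4, h3⟩
    · exact h3 (hmax s h4)
  let m : Fin n → Fin p := fun s => ⟨if s = j then μ j - 1 else if s = k then 0 else μ s, by
    have := hlt s
    split_ifs <;> omega⟩
  have hmj : (m j : ℕ) = μ j - 1 := by simp [m]
  have hm : ∀ s, j < s → (m s : ℕ) = 0 := fun s hs => by
    by_cases h1 : s = k
    · simp [m, h1, hjk.ne']
    · simp [m, h1, hs.ne', hzero s hs h1]
  have h1 := kerVec_mem_kerBaseSpan (.jac₂ i j k hij hjk m (by omega) hm)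
  rw [kerVec_jac₂] at h1
  have h2 : monN p ((fun s => (m s : ℕ)) + Pi.single k (p - 1) + Pi.single i 1) • eC p hjk ∈
      kerBaseSpan p n := by
    refine monN_smul_eC_mem_of_normal hjk _ (fun s hs => ?_) fun _ s hs hs' => ?_
    · simp [hm s (hjk.trans hs), hs.ne', (hij.trans (hjk.trans hs)).ne']
    · simp [hm s hs, hs'.ne, (hij.trans hs).ne']
  convert add_mem h1 h2 using 1
  rw [sub_add_cancel]
  congr 2
  ext s
  simp only [Pi.add_apply, Pi.single_apply, m]
  by_cases h3 : s = j
  · subst h3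
    simp only [if_true, if_neg hjk.ne]
    omega
  · by_cases h4 : s = k
    · subst h4
      simp [h3, hk]
    · simp [h3, h4]

/-- If variables beyond j occur, let k be the last one. Then jac₁ with one factor X_k removed
replaces the monomial by multiples of e₍ⱼ,ₖ₎ and e₍ᵢ,ₖ₎ with no variable beyond k. -/
theorem monN_smul_eC_mem {i j : Fin n} (hij : i < j) (μ : Fin n → ℕ) :
    monN p μ • eC p hij ∈ kerBaseSpan p n := by
  by_cases hmax : ∀ s, j < s → μ s = 0
  · exact monN_smul_eC_mem_of_max hij μ hmax
  refine monN_smul_mem_of_lt fun hlt => ?_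
  push Not at hmax
  obtain ⟨k, ⟨hjk, hk⟩, hlast⟩ := Fin.exists_last_of_exists (P := fun s => j < s ∧ μ s ≠ 0) hmax
  have hltk := hlt k
  let m : Fin n → Fin p := fun s => ⟨if s = k then μ k - 1 else μ s, by
    have := hlt s
    split_ifs <;> omega⟩
  have hmk : (m k : ℕ) = μ k - 1 := by simp [m]
  have hm : ∀ s, k < s → (m s : ℕ) = 0 := fun s hs => by
    have h1 := hlast s hs
    simp only [hjk.trans hs, true_and, ne_eq, not_not] at h1
    simp [m, h1, hs.ne']
  have h1 := kerVec_mem_kerBaseSpan (.jac₁ i j k hij hjk m (by omega) hm)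
  rw [kerVec_jac₁] at h1
  have h2 : ∀ {q r : Fin n} (hqr : q < k) (hrk : r < k),
      monN p ((fun s => (m s : ℕ)) + Pi.single r 1) • eC p hqr ∈ kerBaseSpan p n :=
    fun {q r} hqr hrk => monN_smul_eC_mem_of_max hqr _ fun s hs => by
      simp [hm s hs, (hrk.trans hs).ne']
  convert add_mem (sub_mem h1 (h2 hjk (hij.trans hjk))) (h2 (hij.trans hjk) hjk) using 1
  rw [show μ = (fun s => (m s : ℕ)) + Pi.single k 1 from ?_]
  · abel
  · ext s
    simp only [Pi.add_apply, Pi.single_apply, m]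
    split_ifs with h3
    · subst h3; omega
    · rfl

theorem smul_mem_of_monN {S : Submodule (ZMod p) (FreeMod p n)} {e : FreeMod p n}
    (h : ∀ μ : Fin n → ℕ, monN p μ • e ∈ S) (a : AlgE p n) : a • e ∈ S := by
  induction mem_span_monX a using Submodule.span_induction with
  | mem x hx => obtain ⟨ν, rfl⟩ := hx; exact h _
  | zero => rw [zero_smul]; exact zero_mem _
  | add x y _ _ hx hy => rw [add_smul]; exact add_mem hx hy
  | smul c x _ hx => rw [smul_assoc]; exact S.smul_mem c hx

theorem smul_eC_mem {i j : Fin n} (hij : i < j) (a : AlgE p n) :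
    a • eC p hij ∈ kerBaseSpan p n :=
  smul_mem_of_monN (monN_smul_eC_mem hij) a

theorem smul_eP_mem (i : Fin n) (a : AlgE p n) : a • eP p i ∈ kerBaseSpan p n := by
  refine smul_mem_of_monN (fun μ => monN_smul_mem_of_lt fun hlt => ?_) a
  let m : Fin n → Fin p := fun s => ⟨μ s, hlt s⟩
  by_cases hi : μ i ≠ 0
  · exact kerVec_mem_kerBaseSpan (.rPow i m hi)
  push Not at hi
  by_cases h0 : ∃ s, μ s ≠ 0
  · obtain ⟨j, hj, hlast⟩ := Fin.exists_last_of_exists h0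
    have hlast' : ∀ s, j < s → (m s : ℕ) = 0 := fun s hs => not_not.1 (hlast s hs)
    rcases lt_trichotomy i j with h | rfl | h
    · have h1 := add_mem (kerVec_mem_kerBaseSpan (.rPowLt i j h m hi hj hlast'))
        (smul_eC_mem h (varX p i ^ (p - 1) * varX p j ^ ((m j : ℕ) - 1) *
          ∏ s ∈ Finset.univ \ {i, j}, varX p s ^ (m s : ℕ)))
      rwa [kerVec, sub_add_cancel] at h1
    · exact absurd hi hj
    · have h1 := sub_mem (kerVec_mem_kerBaseSpan (.rPowGt i j h m hi hj hlast'))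
        (smul_eC_mem h (varX p i ^ (p - 1) * varX p j ^ ((m j : ℕ) - 1) *
          ∏ s ∈ Finset.univ \ {i, j}, varX p s ^ (m s : ℕ)))
      rwa [kerVec, add_sub_cancel_right] at h1
  · push Not at h0
    rw [show μ = 0 from funext h0, monN_zero, one_smul]
    exact baseLift_mem_kerBaseSpan (.pow i)

variable (p n) in
theorem kerBaseSpan_eq_top : kerBaseSpan p n = ⊤ := by
  rw [eq_top_iff]
  rintro x -
  induction x using Finsupp.induction_linear with
  | zero => exact zero_mem _
  | add x y hx hy => exact add_mem hx hy
  | single c a =>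
    rw [← mul_one a, ← smul_eq_mul, ← Finsupp.smul_single]
    rcases c with i | ⟨⟨i, j⟩, h⟩
    · exact smul_eP_mem i a
    · exact smul_eC_mem h a

end KerVec

/-! ### The combined basis of the free module and the theorem -/

section Lead

variable {p n : ℕ}

/-- The generator and the exponent vector of the leading term of a vector of the combined basis. -/
def leadTerm : KerIndex p n ⊕ BaseIndex p n →
    (Fin n ⊕ {q : Fin n × Fin n // q.1 < q.2}) × (Fin n → ℕ)
  | .inl (.rPow i m _) => (.inl i, fun s => m s)
  | .inl (.rPowLt i _ _ m _ _ _) => (.inl i, fun s => m s)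
  | .inl (.rPowGt i _ _ m _ _ _) => (.inl i, fun s => m s)
  | .inl (.rComm i j h m _) =>
      (.inr ⟨(i, j), h⟩, fun s => if s = i then p - 1 else if s = j then p - 1 else m s)
  | .inl (.jac₁ i j k hij _ m _ _) =>
      (.inr ⟨(i, j), hij⟩, fun s => if s = k then m s + 1 else m s)
  | .inl (.jac₂ i j k hij hjk m _ _) =>
      (.inr ⟨(i, k), hij.trans hjk⟩,
        fun s => if s = j then m s + 1 else if s = k then p - 1 else m s)
  | .inr (.pow i) => (.inl i, 0)
  | .inr (.comm i j h ν _ _ _) => (.inr ⟨(i, j), h⟩, fun s => ν s)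

variable [Fact p.Prime]

theorem leadTerm_lt (a : KerIndex p n ⊕ BaseIndex p n) (s : Fin n) : (leadTerm a).2 s < p := by
  have hp := (Fact.out : p.Prime).two_le
  rcases a with (⟨i, m, hi⟩ | ⟨i, j, h, m, hi, hj, hm⟩ | ⟨i, j, h, m, hi, hj, hm⟩ |
    ⟨i, j, h, m, hm⟩ | ⟨i, j, k, hij, hjk, m, hk, hm⟩ | ⟨i, j, k, hij, hjk, m, hj, hm⟩) |
    (⟨i⟩ | ⟨i, j, h, ν, h1, h2, h3⟩)
  all_goals simp only [leadTerm, Pi.zero_apply]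
  all_goals grind

/-- The families are separated by their monomials at e₍ᵢ,ⱼ₎: a variable beyond j marks jac₁;
otherwise exponent p - 1 at j with a variable strictly between i and j marks jac₂; otherwise
exponents p - 1 at both i and j mark R(i,j,m); the rest are lifts. Only this injection of index sets
is used, for the count. -/
theorem leadTerm_injective :
    Function.Injective (leadTerm : KerIndex p n ⊕ BaseIndex p n → _) := by
  have hp := (Fact.out : p.Prime).two_le
  intro a b hab
  have hab1 := congrArg Prod.fst hab
  have hab2 := congrFun (congrArg Prod.snd hab)
  clear hab
  rcases a with (⟨i, m, hi⟩ | ⟨i, j, h, m, hi, hj, hm⟩ | ⟨i, j, h, m, hi, hj, hm⟩ |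
    ⟨i, j, h, m, hm⟩ | ⟨i, j, k, hij, hjk, m, hk, hm⟩ | ⟨i, j, k, hij, hjk, m, hj, hm⟩) |
    (⟨i⟩ | ⟨i, j, h, ν, h1, h2, h3⟩) <;>
  rcases b with (⟨i', m', hi'⟩ | ⟨i', j', h', m', hi', hj', hm'⟩ |
    ⟨i', j', h', m', hi', hj', hm'⟩ |
    ⟨i', j', h', m', hm'⟩ | ⟨i', j', k', hij', hjk', m', hk', hm'⟩ |
    ⟨i', j', k', hij', hjk', m', hj', hm'⟩) |
    (⟨i'⟩ | ⟨i', j', h', ν', h1', h2', h3'⟩) <;>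
  simp only [leadTerm, Sum.inl.injEq, Sum.inr.injEq, Subtype.mk.injEq, Prod.mk.injEq, reduceCtorEq,
    Pi.zero_apply, KerIndex.rPow.injEq, KerIndex.rPowLt.injEq, KerIndex.rPowGt.injEq,
    KerIndex.rComm.injEq, KerIndex.jac₁.injEq, KerIndex.jac₂.injEq, BaseIndex.pow.injEq,
    BaseIndex.comm.injEq, funext_iff, Fin.ext_iff] at hab1 hab2 ⊢
  case inl.jac₁.inl.jac₁ =>
    -- The index k is recovered as the largest variable of the monomial.
    have h1 := hab2 k
    have h2 := hab2 k'
    have h3 : k = k' := by rcases lt_trichotomy k k' with h | h | h <;> grind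
    grind
  case inl.jac₂.inl.jac₂ =>
    -- The index j is recovered as the last variable strictly between the two indices of the
    -- generator.
    have h1 := hab2 j
    have h2 := hab2 j'
    have h3 : j = j' := by rcases lt_trichotomy j j' with h | h | h <;> grind
    grind
  all_goals grind

theorem finrank_freeMod : Module.finrank (ZMod p) (FreeMod p n) =
    Fintype.card ((Fin n ⊕ {q : Fin n × Fin n // q.1 < q.2}) × (Fin n → Fin p)) := by
  rw [Module.finrank_finsupp, Fintype.card_prod, card_monomials]

variable (p n) in
/-- The leading term, with its exponents in `{0, …, p - 1}`. -/
def leadTermFin (a : KerIndex p n ⊕ BaseIndex p n) :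
    (Fin n ⊕ {q : Fin n × Fin n // q.1 < q.2}) × (Fin n → Fin p) :=
  ((leadTerm a).1, fun s => ⟨(leadTerm a).2 s, leadTerm_lt a s⟩)

theorem leadTermFin_injective : Function.Injective (leadTermFin p n) := by
  intro a b hab
  have h := congrArg Prod.fst hab
  refine leadTerm_injective (Prod.ext h (funext fun s => ?_))
  exact congrArg Fin.val (congrFun (congrArg Prod.snd hab) s)

-- A spanning family with at most as many members as the dimension is independent.
variable (p n) in
theorem linearIndependent_kerVec_baseLift :
    LinearIndependent (ZMod p) (Sum.elim (kerVec p : KerIndex p n → _) (baseLift p)) := by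
  have := Fintype.ofInjective _ (leadTermFin_injective (p := p) (n := n))
  refine linearIndependent_of_top_le_span_of_card_le_finrank (kerBaseSpan_eq_top p n).ge ?_
  rw [finrank_freeMod]
  exact Fintype.card_le_of_injective _ leadTermFin_injective

theorem exists_decomposition (x : FreeMod p n) :
    ∃ k ∈ Submodule.span (ZMod p) (Set.range (kerVec p : KerIndex p n → _)),
      ∃ l : BaseIndex p n →₀ ZMod p, x = k + Finsupp.linearCombination (ZMod p) (baseLift p) l := by
  have h : x ∈ kerBaseSpan p n := kerBaseSpan_eq_top p n ▸ Submodule.mem_top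
  rw [kerBaseSpan, Set.Sum.elim_range, Submodule.span_union, Submodule.mem_sup] at h
  obtain ⟨k, hk, y, hy, rfl⟩ := h
  obtain ⟨l, rfl⟩ := (Finsupp.mem_span_range_iff_exists_finsupp).1 hy
  exact ⟨k, hk, l, rfl⟩

theorem psi_linearCombination_baseLift (l : BaseIndex p n →₀ ZMod p) :
    psi p n (Finsupp.linearCombination (ZMod p) (baseLift p) l) =
      Finsupp.linearCombination (ZMod p) (baseVec p) l := by
  have h := Finsupp.apply_linearCombination (ZMod p) ((psi p n).restrictScalars (ZMod p))
    (baseLift p) l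
  refine h.trans ?_
  congr 2
  funext a
  exact psi_baseLift a

theorem span_kerVec_le_ker : Submodule.span (ZMod p) (Set.range (kerVec p : KerIndex p n → _)) ≤
    (LinearMap.ker (psi p n)).restrictScalars (ZMod p) := by
  rw [Submodule.span_le]
  rintro _ ⟨a, rfl⟩
  exact span_defRel_le_ker (kerVec_mem a)

/-- Independence of the basis vectors in Mₙ forces the lifted part of a kernel element to vanish. -/
theorem ker_psi_le_span_kerVec : (LinearMap.ker (psi p n)).restrictScalars (ZMod p) ≤
    Submodule.span (ZMod p) (Set.range (kerVec p : KerIndex p n → _)) := by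
  intro x hx
  obtain ⟨k, hk, l, rfl⟩ := exists_decomposition x
  have h1 : psi p n k = 0 := span_kerVec_le_ker hk
  have h2 : psi p n (k + Finsupp.linearCombination (ZMod p) (baseLift p) l) = 0 := hx
  rw [map_add, h1, zero_add, psi_linearCombination_baseLift] at h2
  rw [linearIndependent_iff.1 (linearIndependent_baseVec p n) l h2, map_zero, add_zero]
  exact hk

variable (p n)

theorem ker_psi_eq : LinearMap.ker (psi p n) = Submodule.span (AlgE p n) {r | DefRel p n r} := by
  refine le_antisymm (fun x hx => ?_) span_defRel_le_ker
  have h : Submodule.span (ZMod p) (Set.range (kerVec p : KerIndex p n → _)) ≤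
      (Submodule.span (AlgE p n) {r | DefRel p n r}).restrictScalars (ZMod p) := by
    rw [Submodule.span_le]
    rintro _ ⟨a, rfl⟩
    exact kerVec_mem a
  exact h (ker_psi_le_span_kerVec hx)

theorem exists_basis_ker_psi :
    ∃ b : Module.Basis (KerIndex p n) (ZMod p) (LinearMap.ker (psi p n)),
      ∀ a, (b a : FreeMod p n) = kerVec p a := by
  let f : LinearMap.ker (psi p n) →ₗ[ZMod p] FreeMod p n :=
    (LinearMap.ker (psi p n)).subtype.restrictScalars (ZMod p)
  have hf : Function.Injective f := Subtype.val_injective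
  let v : KerIndex p n → LinearMap.ker (psi p n) :=
    fun a => ⟨kerVec p a, span_defRel_le_ker (kerVec_mem a)⟩
  have hv : LinearIndependent (ZMod p) v :=
    LinearIndependent.of_comp f
      ((linearIndependent_kerVec_baseLift p n).comp Sum.inl Sum.inl_injective)
  refine ⟨Module.Basis.mk hv ?_, fun a => by rw [Module.Basis.mk_apply]⟩
  rintro x -
  have h : f x ∈ (Submodule.span (ZMod p) (Set.range v)).map f := by
    rw [Submodule.map_span, ← Set.range_comp]
    exact ker_psi_le_span_kerVec x.2
  obtain ⟨y, hy, hyx⟩ := h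
  exact hf hyx ▸ hy

theorem exists_basis_modM :
    ∃ b : Module.Basis (BaseIndex p n) (ZMod p) (ModM p n), ∀ a, b a = baseVec p a := by
  refine ⟨Module.Basis.mk (linearIndependent_baseVec p n) ?_,
    fun a => by rw [Module.Basis.mk_apply]⟩
  rintro m -
  obtain ⟨x, rfl⟩ := psi_surjective p n m
  obtain ⟨k, hk, l, rfl⟩ := exists_decomposition x
  have h1 : psi p n k = 0 := span_kerVec_le_ker hk
  rw [map_add, h1, zero_add, psi_linearCombination_baseLift]
  exact Finsupp.mem_span_range_iff_exists_finsupp.2 ⟨l, rfl⟩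

end Lead

theorem mainTheorem5 (p n : ℕ) [Fact p.Prime] (hp : p ≠ 2) :
    -- presentation of `Mₙ` by generators and relations
    (Function.Surjective (psi p n) ∧
      LinearMap.ker (psi p n) = Submodule.span (AlgE p n) {r | DefRel p n r}) ∧
    -- basis of the kernel of `ψ` over `𝐅ₚ`
    (∃ b : Module.Basis (KerIndex p n) (ZMod p) (LinearMap.ker (psi p n)),
      ∀ a, (b a : FreeMod p n) = kerVec p a) ∧
    -- basis of `Mₙ` over `𝐅ₚ`
    (∃ b : Module.Basis (BaseIndex p n) (ZMod p) (ModM p n), ∀ a, b a = baseVec p a) :=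
  ⟨⟨psi_surjective p n, ker_psi_eq p n⟩, exists_basis_ker_psi p n, exists_basis_modM p n⟩
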